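/- **Theorem (Tameness of central lines).** Let $\mathbb{P}^1=\mathbb{C}\cup\{\infty\}$ be the Riemann sphere with its chordal metric, and fix $L>0$. Let $S=\{x+iy : |y|<L\}$ be the standard strip and $T:S\to S$, $T(z)=z-1$. For a rational map $f:\mathbb{P}^1\to\mathbb{P}^1$, an *invariant strip* of $f$ is an open simply connected set $A\subset\mathbb{P}^1$ such that $f|_A$ is holomorphically conjugate to $T$ on $S$, i.e. there is a conformal isomorphism $h:S\to A$ with $f\circ h=h\circ T$. The *central line* of $A$ is the unique hyperbolic geodesic $\gamma$ of $A$ with $f(\gamma)=\gamma$. Let $f_n$ $(n\in\mathbb{N})$ and $g$ be rational maps of degree at least $2$ with $f_n\to g$ uniformly on $\mathbb{P}^1$. For each $n$ let $A_n$ be an invariant strip of $f_n$ with central line $\gamma_n$, and suppose that $\overline{\gamma_n}\to\Gamma$ in the Hausdorff topology on compact subsets of $\mathbb{P}^1$. If $\Gamma$ is not a single point, then there is a non-empty, finite or countably infinite, family $\{S_e\}_{e\in E}$ of pairwise disjoint invariant strips of $g$ (for the same $L$), with central lines $\gamma_e$, such that $$\Gamma\setminus\mathrm{Fix}(g)=\bigcup_{e\in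 E}\gamma_e\qquad\text{and}\qquad \Gamma=\bigcup_{e\in E}\overline{\gamma_e},$$ where $\mathrm{Fix}(g)=\{z\in\mathbb{P}^1 : g(z)=z\}$. -/

import Mathlib

open Set Filter Topology

noncomputable section

namespace RiemannSphere

/-- Stereographic projection of the Riemann sphere `OnePoint ℂ` to the unit sphere of
`ℂ × ℝ` (with its Euclidean norm), sending `∞` to the north pole. -/
def stereo (p : OnePoint ℂ) : WithLp 2 (ℂ × ℝ) :=
  p.elim (WithLp.toLp 2 (0, 1)) fun z =>
    WithLp.toLp 2 ((2 / (1 + ‖z‖ ^ 2) : ℝ) • z, 1 - 2 / (1 + ‖z‖ ^ 2))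

theorem continuous_stereo : Continuous stereo := by
  rw [OnePoint.continuous_iff]
  have hpos : ∀ z : ℂ, (1 + ‖z‖ ^ 2 : ℝ) ≠ 0 := fun z => by positivity
  constructor
  · rw [coclosedCompact_eq_cocompact]
    have hn : Tendsto (fun z : ℂ => ‖z‖) (cocompact ℂ) atTop := tendsto_norm_cocompact_atTop
    have h1 : Tendsto (fun z : ℂ => 2 / (1 + ‖z‖ ^ 2)) (cocompact ℂ) (𝓝 0) :=
      Tendsto.const_div_atTop
        (tendsto_atTop_add_const_left _ _ ((tendsto_pow_atTop two_ne_zero).comp hn)) 2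
    have h2 : Tendsto (fun z : ℂ => (2 / (1 + ‖z‖ ^ 2) : ℝ) • z) (cocompact ℂ) (𝓝 0) := by
      rw [tendsto_zero_iff_norm_tendsto_zero]
      have h3 : Tendsto (fun z : ℂ => 2 / ‖z‖) (cocompact ℂ) (𝓝 0) := hn.const_div_atTop 2
      refine squeeze_zero (fun z => norm_nonneg _) (fun z => ?_) h3
      rw [norm_smul, Real.norm_of_nonneg (by positivity)]
      rcases eq_or_ne z 0 with rfl | hz
      · simp
      · have : 0 < ‖z‖ := norm_pos_iff.2 hz
        rw [div_mul_eq_mul_div, div_le_div_iff₀ (by positivity) this]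
        nlinarith
    have h4 : Tendsto (fun z : ℂ => ((2 / (1 + ‖z‖ ^ 2) : ℝ) • z, 1 - 2 / (1 + ‖z‖ ^ 2)))
        (cocompact ℂ) (𝓝 ((0 : ℂ), (1 : ℝ))) := by
      refine h2.prodMk_nhds ?_
      simpa using h1.const_sub 1
    exact ((WithLp.prod_continuous_toLp 2 ℂ ℝ).tendsto _).comp h4
  · refine (WithLp.prod_continuous_toLp 2 ℂ ℝ).comp ?_
    fun_prop (disch := exact hpos _)

theorem stereo_injective : Function.Injective stereo := by
  have hpos : ∀ z : ℂ, (0 : ℝ) < 2 / (1 + ‖z‖ ^ 2) := fun z => by positivity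
  intro p q h
  induction p using OnePoint.rec with
  | infty =>
    induction q using OnePoint.rec with
    | infty => rfl
    | coe w =>
      have h1 : (1 : ℝ) = 1 - 2 / (1 + ‖w‖ ^ 2) :=
        congrArg (fun v : WithLp 2 (ℂ × ℝ) => v.snd) h
      have := hpos w
      linarith
  | coe z =>
    induction q using OnePoint.rec with
    | infty =>
      have h1 : 1 - 2 / (1 + ‖z‖ ^ 2) = (1 : ℝ) :=
        congrArg (fun v : WithLp 2 (ℂ × ℝ) => v.snd) h
      have := hpos z
      linarith
    | coe w =>
      have h1 : (1 - 2 / (1 + ‖z‖ ^ 2) : ℝ) = 1 - 2 / (1 + ‖w‖ ^ 2) :=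
        congrArg (fun v : WithLp 2 (ℂ × ℝ) => v.snd) h
      have h2 : (2 / (1 + ‖z‖ ^ 2) : ℝ) • z = (2 / (1 + ‖w‖ ^ 2) : ℝ) • w :=
        congrArg (fun v : WithLp 2 (ℂ × ℝ) => v.fst) h
      have h3 : (2 / (1 + ‖z‖ ^ 2) : ℝ) = 2 / (1 + ‖w‖ ^ 2) := by linarith
      rw [h3] at h2
      exact congrArg _ (smul_right_injective ℂ (hpos w).ne' h2)

theorem isEmbedding_stereo : IsEmbedding stereo :=
  (continuous_stereo.isClosedEmbedding stereo_injective).isEmbedding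

/-- The chordal metric on the Riemann sphere. Its topology is definitionally the
topology of the one-point compactification. -/
instance instMetricSpaceSphere : MetricSpace (OnePoint ℂ) :=
  isEmbedding_stereo.comapMetricSpace stereo

/-- The point `[a : b]` of the projective line, for `(a, b) ≠ (0, 0)`. -/
def ratio (a b : ℂ) : OnePoint ℂ :=
  open Classical in if b = 0 then OnePoint.infty else ((a / b : ℂ) : OnePoint ℂ)

/-- `f` is a rational map of the Riemann sphere of degree `d`: in homogeneous coordinates
it is given by the coprime polynomials `p`, `q` homogenized in degree
`d = max (deg p) (deg q)`. -/
def IsRationalMap (d : ℕ) (f : OnePoint ℂ → OnePoint ℂ) : Prop :=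
  ∃ p q : Polynomial ℂ, IsCoprime p q ∧ max p.natDegree q.natDegree = d ∧
    (∀ z : ℂ, f z = ratio (p.eval z) (q.eval z)) ∧
    f OnePoint.infty = ratio (p.coeff d) (q.coeff d)

/-- The affine coordinate `z` (junk value `0` at `∞`). -/
def coordZero (p : OnePoint ℂ) : ℂ := p.elim 0 fun z => z

/-- The coordinate `1 / z` around `∞` (junk value `0` at `0`). -/
def coordInfty (p : OnePoint ℂ) : ℂ := p.elim 0 fun z => z⁻¹

/-- `h` is holomorphic on the open set `U ⊆ ℂ` as a map to the Riemann sphere: it is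
continuous, and holomorphic when read in the two standard charts of the sphere. -/
def HolomorphicOn (h : ℂ → OnePoint ℂ) (U : Set ℂ) : Prop :=
  ContinuousOn h U ∧ ∀ z ∈ U,
    (h z ≠ OnePoint.infty → DifferentiableAt ℂ (fun w => coordZero (h w)) z) ∧
    (h z ≠ ((0 : ℂ) : OnePoint ℂ) → DifferentiableAt ℂ (fun w => coordInfty (h w)) z)

/-- `h` restricts to a conformal isomorphism from the open set `U ⊆ ℂ` onto the subset `A`
of the Riemann sphere. -/
def IsConformalIso (h : ℂ → OnePoint ℂ) (U : Set ℂ) (A : Set (OnePoint ℂ)) : Prop :=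
  HolomorphicOn h U ∧ InjOn h U ∧ h '' U = A

/-- The standard strip `{x + i y : |y| < L}`. -/
def standardStrip (L : ℝ) : Set ℂ := {z | |z.im| < L}

/-- `A` is an invariant strip of `f` (with parameter `L`): it is open and simply connected, and
`f` restricted to `A` is holomorphically conjugate to `z ↦ z - 1` on the standard strip. -/
def IsInvariantStrip (L : ℝ) (f : OnePoint ℂ → OnePoint ℂ) (A : Set (OnePoint ℂ)) : Prop :=
  IsOpen A ∧ IsSimplyConnected A ∧
    ∃ h : ℂ → OnePoint ℂ, IsConformalIso h (standardStrip L) A ∧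
      ∀ z ∈ standardStrip L, f (h z) = h (z - 1)

/-- `γ` is a complete hyperbolic geodesic of the simply connected domain `A`: a uniformization
of `A` by the upper half-plane carries onto `γ` the image of an isometric embedding of the real
line in the upper half-plane with its hyperbolic distance. -/
def IsHyperbolicGeodesic (A γ : Set (OnePoint ℂ)) : Prop :=
  ∃ (φ : ℂ → OnePoint ℂ) (c : ℝ → UpperHalfPlane),
    IsConformalIso φ {z | 0 < z.im} A ∧ Isometry c ∧ γ = range fun t => φ (c t : ℂ)

/-- `γ` is the central line of the invariant strip `A` of `f`: the hyperbolic geodesic of `A`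
stabilized by `f`. -/
def IsCentralLine (f : OnePoint ℂ → OnePoint ℂ) (A γ : Set (OnePoint ℂ)) : Prop :=
  IsHyperbolicGeodesic A γ ∧ f '' γ = γ

end RiemannSphere

end

/-!
Let `h n` parametrize `A n` by the standard strip, conjugating `z ↦ z - 1` to `f n`, so that `γ n`
is the image of the real axis. A strip map omits every point whose image is fixed, and a rational
map of degree at least two has two such points, which persist under perturbation. Hence, by
Bloch's theorem, any family of rebased maps `z ↦ h n (z + t n)` is equicontinuous; along an
ultrafilter it has a limit, which by Hurwitz' theorem is again a strip map, for `g`, or a constant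
fixed point of `g`. Two limit strips that meet are translates of each other, again by Hurwitz, and
their central lines make up `Γ` outside the fixed points.

To reach a fixed point `p ∈ Γ`, follow `γ n` from a point near `p` towards a point near some other
`q ∈ Γ` and rebase `h n` where the curve first leaves a small ball around `p`. The exit times tend
to infinity because the limit based near `p` is constant, so the limit based at the exit points has
a whole half-line in the ball. It tends to a fixed point of `g` along this half-line, and `p` is the
only one in the ball.
-/

/-! ### Complex analysis in the plane -/

theorem eventually_nhdsNE_ne_of_injOn {X Y : Type*} [TopologicalSpace X] {h : X → Y} {U : Set X}
    {z : X} (hU : U ∈ 𝓝 z) (hi : InjOn h U) : ∀ᶠ w in 𝓝[≠] z, h w ≠ h z := by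
  filter_upwards [self_mem_nhdsWithin, nhdsWithin_le_nhds hU] with w hw hwU h_eq
  exact hw (hi hwU (mem_of_mem_nhds hU) h_eq)

theorem le_norm_center_of_forall_sphere_le_norm {F : ℂ → ℂ} {z : ℂ} {r c : ℝ} (hr : 0 < r)
    (hc : 0 < c) (hd : DiffContOnCl ℂ F (Metric.ball z r))
    (hne : ∀ w ∈ Metric.ball z r, F w ≠ 0) (hS : ∀ w ∈ Metric.sphere z r, c ≤ ‖F w‖) :
    c ≤ ‖F z‖ := by
  have hz : z ∈ Metric.ball z r := Metric.mem_ball_self hr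
  have hne' : ∀ w ∈ closure (Metric.ball z r), F w ≠ 0 := by
    rw [closure_ball z hr.ne', ← Metric.ball_union_sphere]
    rintro w (hw | hw)
    · exact hne w hw
    · exact norm_pos_iff.1 (hc.trans_le (hS w hw))
  have hmax : ‖F⁻¹ z‖ ≤ c⁻¹ := by
    refine Complex.norm_le_of_forall_mem_frontier_norm_le Metric.isBounded_ball (hd.inv hne')
      (fun w hw => ?_) (subset_closure hz)
    rw [frontier_ball z hr.ne'] at hw
    rw [Pi.inv_apply, norm_inv]
    exact inv_anti₀ hc (hS w hw)
  rwa [Pi.inv_apply, norm_inv, inv_le_inv₀ (norm_pos_iff.2 (hne z hz)) hc] at hmax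

theorem eventually_exists_zero_of_tendstoUniformlyOn {ι : Type*} {l : Filter ι} {F : ι → ℂ → ℂ}
    {F₀ : ℂ → ℂ} {z : ℂ} {r : ℝ} (hr : 0 < r)
    (hd : ∀ᶠ i in l, DiffContOnCl ℂ (F i) (Metric.ball z r))
    (hu : TendstoUniformlyOn F F₀ l (Metric.closedBall z r))
    (hc : ContinuousOn F₀ (Metric.sphere z r)) (hne : ∀ w ∈ Metric.sphere z r, F₀ w ≠ 0)
    (h0 : F₀ z = 0) : ∀ᶠ i in l, ∃ w ∈ Metric.ball z r, F i w = 0 := by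
  obtain ⟨w₀, hw₀, hmin⟩ := (isCompact_sphere z r).exists_isMinOn
    (NormedSpace.sphere_nonempty.2 hr.le) hc.norm
  have hm : 0 < ‖F₀ w₀‖ / 2 := half_pos (norm_pos_iff.2 (hne _ hw₀))
  filter_upwards [hd, Metric.tendstoUniformlyOn_iff.1 hu _ hm] with i hi hclose
  by_contra! hcon
  have hz := hclose z (Metric.mem_closedBall_self hr.le)
  rw [h0, dist_zero_left] at hz
  refine hz.not_ge (le_norm_center_of_forall_sphere_le_norm hr hm hi hcon fun w hw => ?_)
  have h1 := hclose w (Metric.sphere_subset_closedBall hw)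
  rw [dist_eq_norm] at h1
  have h2 : ‖F₀ w₀‖ ≤ ‖F₀ w‖ := hmin hw
  linarith [norm_sub_norm_le (F₀ w) (F i w)]

theorem exists_ball_forall_le_two_mul {X : Type*} [PseudoMetricSpace X] [ProperSpace X]
    {φ : X → ℝ} {z : X} {r : ℝ} (hr : 0 < r) (hφ : ContinuousOn φ (Metric.closedBall z r))
    (hφ0 : ∀ w ∈ Metric.closedBall z r, 0 ≤ φ w) (hz : 0 < φ z) :
    ∃ a, ∃ ρ > 0, Metric.ball a ρ ⊆ Metric.closedBall z r ∧ r * φ z ≤ 2 * (ρ * φ a) ∧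
      ∀ w ∈ Metric.ball a ρ, φ w ≤ 2 * φ a := by
  have hcont : ContinuousOn (fun w => (r - dist w z) * φ w) (Metric.closedBall z r) := by fun_prop
  obtain ⟨a, ha, hmax⟩ := (isCompact_closedBall z r).exists_isMaxOn
    (Metric.nonempty_closedBall.2 hr.le) hcont
  have hmax : ∀ w ∈ Metric.closedBall z r, (r - dist w z) * φ w ≤ (r - dist a z) * φ a := hmax
  have hza : r * φ z ≤ (r - dist a z) * φ a := by
    simpa using hmax z (Metric.mem_closedBall_self hr.le)
  have hρ : 0 < (r - dist a z) / 2 :=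
    half_pos (pos_of_mul_pos_left ((mul_pos hr hz).trans_le hza) (hφ0 a ha))
  have hball : Metric.ball a ((r - dist a z) / 2) ⊆ Metric.closedBall z r := fun w hw => by
    have h1 := dist_triangle w a z
    have h2 := Metric.mem_ball.1 hw
    exact Metric.mem_closedBall.2 (by linarith)
  refine ⟨a, _, hρ, hball, by linarith, fun w hw => le_of_mul_le_mul_left ?_ hρ⟩
  have hdist : (r - dist a z) / 2 ≤ r - dist w z := by
    have h1 := dist_triangle w a z
    have h2 := Metric.mem_ball.1 hw
    linarith
  calc (r - dist a z) / 2 * φ w ≤ (r - dist w z) * φ w :=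
        mul_le_mul_of_nonneg_right hdist (hφ0 w (hball hw))
    _ ≤ (r - dist a z) * φ a := hmax w (hball hw)
    _ = (r - dist a z) / 2 * (2 * φ a) := by ring

section Bloch

variable {G : ℂ → ℂ} {a : ℂ} {ρ : ℝ}

theorem norm_sub_sub_deriv_mul_le_of_norm_deriv_le (hρ : 0 < ρ)
    (hd : DifferentiableOn ℂ G (Metric.ball a ρ))
    (hb : ∀ w ∈ Metric.ball a ρ, ‖deriv G w‖ ≤ 2 * ‖deriv G a‖) {w : ℂ}
    (hw : w ∈ Metric.closedBall a (ρ / 6)) :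
    ‖G w - G a - deriv G a * (w - a)‖ ≤ ‖deriv G a‖ / 2 * ‖w - a‖ := by
  have hsub : Metric.closedBall a (ρ / 6) ⊆ Metric.ball a ρ :=
    Metric.closedBall_subset_ball (by linarith)
  have hderiv : ∀ x ∈ Metric.closedBall a (ρ / 6), ‖deriv G x - deriv G a‖ ≤ ‖deriv G a‖ / 2 := by
    intro x hx
    have hmaps : MapsTo (deriv G) (Metric.ball a ρ)
        (Metric.closedBall (deriv G a) (3 * ‖deriv G a‖)) := fun y hy => by
      rw [mem_closedBall_iff_norm]
      linarith [norm_sub_le (deriv G y) (deriv G a), hb y hy]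
    rw [← dist_eq_norm]
    calc dist (deriv G x) (deriv G a) ≤ 3 * ‖deriv G a‖ / ρ * dist x a :=
          Complex.dist_le_div_mul_dist_of_mapsTo_ball (hd.deriv Metric.isOpen_ball) hmaps (hsub hx)
      _ ≤ 3 * ‖deriv G a‖ / ρ * (ρ / 6) := by gcongr; exact hx
      _ = ‖deriv G a‖ / 2 := by field_simp; ring
  have hmean := (convex_closedBall a (ρ / 6)).norm_image_sub_le_of_norm_hasDerivWithin_le
    (f := fun x => G x - deriv G a * x) (fun x hx =>
      ((hd.differentiableAt (Metric.isOpen_ball.mem_nhds (hsub hx))).hasDerivAt.fun_sub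
        ((hasDerivAt_id x).const_mul (deriv G a))).hasDerivWithinAt)
    (by simpa only [mul_one] using hderiv) (Metric.mem_closedBall_self (by positivity)) hw
  rwa [sub_sub_sub_comm, ← mul_sub] at hmean

theorem ball_subset_image_of_norm_deriv_le (hρ : 0 < ρ)
    (hd : DifferentiableOn ℂ G (Metric.ball a ρ))
    (hb : ∀ w ∈ Metric.ball a ρ, ‖deriv G w‖ ≤ 2 * ‖deriv G a‖) :
    Metric.ball (G a) (ρ * ‖deriv G a‖ / 24) ⊆ G '' Metric.ball a ρ := by
  rcases eq_or_ne (deriv G a) 0 with h0 | h0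
  · simp [h0]
  have hsub : Metric.closedBall a (ρ / 6) ⊆ Metric.ball a ρ :=
    Metric.closedBall_subset_ball (by linarith)
  have hd' : DiffContOnCl ℂ G (Metric.ball a (ρ / 6)) :=
    hd.diffContOnCl_ball hsub
  have hsphere : ∀ w ∈ Metric.sphere a (ρ / 6), ρ * ‖deriv G a‖ / 12 ≤ ‖G w - G a‖ := by
    intro w hw
    have hlin := norm_sub_sub_deriv_mul_le_of_norm_deriv_le hρ hd hb
      (Metric.sphere_subset_closedBall hw)
    have htri := norm_sub_norm_le (deriv G a * (w - a)) (deriv G a * (w - a) - (G w - G a))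
    rw [norm_sub_rev _ (G w - G a), sub_sub_cancel, norm_mul] at htri
    rw [mem_sphere_iff_norm.1 hw] at hlin htri
    linarith
  have hnonconst : ∃ᶠ w in 𝓝 a, G w ≠ G a :=
    ((hd.differentiableAt (Metric.ball_mem_nhds a hρ)).hasDerivAt.eventually_ne
      h0).frequently.filter_mono nhdsWithin_le_nhds
  refine Subset.trans (Metric.ball_subset_ball (by linarith)) <|
    (hd'.ball_subset_image_closedBall (by positivity) hsphere hnonconst).trans (image_mono hsub)

/-- **Bloch's theorem**, with a non-optimal constant. -/
theorem exists_ball_subset_image_ball {z : ℂ} {r R : ℝ} (hr : 0 < r) (hrR : r < R)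
    (hd : DifferentiableOn ℂ G (Metric.ball z R)) :
    ∃ c, Metric.ball c (r * ‖deriv G z‖ / 48) ⊆ G '' Metric.ball z R := by
  rcases eq_or_ne (deriv G z) 0 with h0 | h0
  · exact ⟨0, by simp [h0]⟩
  have hsub : Metric.closedBall z r ⊆ Metric.ball z R := Metric.closedBall_subset_ball hrR
  obtain ⟨a, ρ, hρ, hball, hle, hb⟩ := exists_ball_forall_le_two_mul hr
    ((hd.deriv Metric.isOpen_ball).continuousOn.mono hsub).norm (fun _ _ => norm_nonneg _)
    (norm_pos_iff.2 h0)
  exact ⟨G a, (Metric.ball_subset_ball (by linarith)).trans <|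
    (ball_subset_image_of_norm_deriv_le hρ (hd.mono (hball.trans hsub)) hb).trans <|
      image_mono (hball.trans hsub)⟩

end Bloch

section Univalent

variable {F : ℂ → ℂ} {z : ℂ} {R : ℝ}

theorem exists_hasDerivAt_logDeriv_and_exp_eq (hd : DifferentiableOn ℂ F (Metric.ball z R))
    (h0 : ∀ w ∈ Metric.ball z R, F w ≠ 0) :
    ∃ G : ℂ → ℂ, (∀ w ∈ Metric.ball z R, HasDerivAt G (logDeriv F w) w) ∧
      ∀ w ∈ Metric.ball z R, Complex.exp (G w) = F w := by
  obtain ⟨G, hG⟩ := ((hd.deriv Metric.isOpen_ball).fun_div hd h0).isExactOn_ball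
  have hexp : ∀ w ∈ Metric.ball z R,
      HasDerivAt (fun w => Complex.exp (G w)) (Complex.exp (G w) * logDeriv F w) w :=
    fun w hw => (hG w hw).cexp
  obtain ⟨c, hc, hcF⟩ := (logDeriv_eqOn_iff hd
    (fun w hw => (hexp w hw).differentiableAt.differentiableWithinAt) Metric.isOpen_ball
    (convex_ball z R).isPreconnected (fun w _ => Complex.exp_ne_zero _) h0).1 (fun w hw => by
      rw [logDeriv_apply (fun w => Complex.exp (G w)), (hexp w hw).deriv,
        mul_div_cancel_left₀ _ (Complex.exp_ne_zero _)])
  refine ⟨fun w => Complex.log c + G w, fun w hw => (hG w hw).const_add _, fun w hw => ?_⟩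
  rw [Complex.exp_add, Complex.exp_log hc, hcF hw, Pi.smul_apply, smul_eq_mul]

theorem norm_logDeriv_le_of_injOn (hR : 0 < R) (hd : DifferentiableOn ℂ F (Metric.ball z R))
    (h0 : ∀ w ∈ Metric.ball z R, F w ≠ 0) (hi : InjOn F (Metric.ball z R)) :
    ‖logDeriv F z‖ ≤ 400 / R := by
  obtain ⟨G, hG, hexp⟩ := exists_hasDerivAt_logDeriv_and_exp_eq hd h0
  obtain ⟨c, hc⟩ := exists_ball_subset_image_ball (half_pos hR) (half_lt_self hR)
    (fun w hw => (hG w hw).differentiableAt.differentiableWithinAt)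
  rw [(hG z (Metric.mem_ball_self hR)).deriv] at hc
  by_contra! hlt
  have hbig : Real.pi < R / 2 * ‖logDeriv F z‖ / 48 := by
    rw [div_lt_iff₀ hR] at hlt
    linarith [Real.pi_lt_four]
  have hmem : ∀ ε : ℂ, ‖ε‖ = Real.pi → c + ε ∈ G '' Metric.ball z R := fun ε hε =>
    hc (by rwa [Metric.mem_ball, dist_eq_norm, add_sub_cancel_left, hε])
  -- The image of `G` contains two points that differ by the period `2πi` of `exp`.
  obtain ⟨x, hx, hGx⟩ := hmem (Real.pi * Complex.I) (by simp [abs_of_pos Real.pi_pos])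
  obtain ⟨y, hy, hGy⟩ := hmem (-(Real.pi * Complex.I)) (by simp [abs_of_pos Real.pi_pos])
  have hxy : x = y := hi hx hy (by
    rw [← hexp x hx, ← hexp y hy, hGx, hGy, Complex.exp_add, Complex.exp_add, Complex.exp_neg,
      Complex.exp_pi_mul_I, inv_neg, inv_one])
  rw [hxy, hGy, add_left_cancel_iff, neg_eq_self, mul_eq_zero] at hGx
  simp [Real.pi_ne_zero] at hGx

theorem norm_sub_le_of_injOn_of_ne_zero (hR : 0 < R)
    (hd : DifferentiableOn ℂ F (Metric.ball z (2 * R)))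
    (h0 : ∀ w ∈ Metric.ball z (2 * R), F w ≠ 0) (hi : InjOn F (Metric.ball z (2 * R))) {x y : ℂ}
    (hx : x ∈ Metric.ball z (R / 800)) (hy : y ∈ Metric.ball z (R / 800)) :
    ‖F x - F y‖ ≤ 800 / R * ‖x - y‖ * ‖F y‖ := by
  have hsub : Metric.ball z R ⊆ Metric.ball z (2 * R) := Metric.ball_subset_ball (by linarith)
  obtain ⟨G, hG, hexp⟩ := exists_hasDerivAt_logDeriv_and_exp_eq (hd.mono hsub)
    fun w hw => h0 w (hsub hw)
  have hx' : x ∈ Metric.ball z R := Metric.ball_subset_ball (by linarith) hx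
  have hy' : y ∈ Metric.ball z R := Metric.ball_subset_ball (by linarith) hy
  have hlip : ‖G x - G y‖ ≤ 400 / R * ‖x - y‖ := by
    refine (convex_ball z R).norm_image_sub_le_of_norm_hasDerivWithin_le
      (fun w hw => (hG w hw).hasDerivWithinAt) (fun w hw => ?_) hy' hx'
    have hw2 : Metric.ball w R ⊆ Metric.ball z (2 * R) :=
      Metric.ball_subset_ball' (by linarith [Metric.mem_ball.1 hw])
    exact norm_logDeriv_le_of_injOn hR (hd.mono hw2) (fun v hv => h0 v (hw2 hv)) (hi.mono hw2)
  have hle1 : ‖G x - G y‖ ≤ 1 := by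
    have hxy : ‖x - y‖ ≤ R / 400 := by
      rw [← dist_eq_norm]
      linarith [dist_triangle_right x y z, Metric.mem_ball.1 hx, Metric.mem_ball.1 hy]
    calc ‖G x - G y‖ ≤ 400 / R * ‖x - y‖ := hlip
      _ ≤ 400 / R * (R / 400) := by gcongr
      _ = 1 := by field_simp
  have hdiff : F x - F y = (Complex.exp (G x - G y) - 1) * F y := by
    rw [sub_one_mul, ← hexp x hx', ← hexp y hy', ← Complex.exp_add, sub_add_cancel]
  calc ‖F x - F y‖ = ‖Complex.exp (G x - G y) - 1‖ * ‖F y‖ := by rw [hdiff, norm_mul]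
    _ ≤ 2 * ‖G x - G y‖ * ‖F y‖ := by gcongr; exact Complex.norm_exp_sub_one_le hle1
    _ ≤ 2 * (400 / R * ‖x - y‖) * ‖F y‖ := by gcongr
    _ = 800 / R * ‖x - y‖ * ‖F y‖ := by ring

end Univalent

theorem tendstoUniformlyOn_comp_of_isCompact {α X Y ι : Type*} [TopologicalSpace α]
    [PseudoMetricSpace X] [ProperSpace X] [UniformSpace Y] {l : Filter ι} {κ : X → Y} {V : Set X}
    (hV : IsOpen V) (hκ : ContinuousOn κ V) {u : ι → α → X} {h : α → X} {K : Set α}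
    (hK : IsCompact K) (hc : ContinuousOn h K) (hm : MapsTo h K V)
    (hu : TendstoUniformlyOn u h l K) :
    (∀ᶠ i in l, MapsTo (u i) K V) ∧
      TendstoUniformlyOn (fun i w => κ (u i w)) (fun w => κ (h w)) l K := by
  have hhK := hK.image_of_continuousOn hc
  obtain ⟨δ, hδ, hδV⟩ := hhK.exists_cthickening_subset_open hV hm.image_subset
  have hnear : ∀ᶠ i in l, MapsTo (u i) K (Metric.cthickening δ (h '' K)) := by
    filter_upwards [Metric.tendstoUniformlyOn_iff.1 hu δ hδ] with i hi w hw
    exact Metric.mem_cthickening_of_dist_le _ _ _ _ (mem_image_of_mem h hw)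
      (by rw [dist_comm]; exact (hi w hw).le)
  refine ⟨hnear.mono fun i hi => hi.mono_right hδV, ?_⟩
  exact (hhK.cthickening.uniformContinuousOn_of_continuous
    (hκ.mono hδV)).comp_tendstoUniformlyOn_eventually hnear
    (fun w hw => Metric.self_subset_cthickening _ (mem_image_of_mem h hw)) hu

namespace RiemannSphere

/-! ### Holomorphic maps to the sphere -/

@[simp] theorem coordZero_coe (z : ℂ) : coordZero (z : OnePoint ℂ) = z := rfl

@[simp] theorem coordInfty_coe (z : ℂ) : coordInfty (z : OnePoint ℂ) = z⁻¹ := rfl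

@[simp] theorem coordInfty_infty : coordInfty OnePoint.infty = 0 := rfl

/-- `κ` is a holomorphic chart of the sphere with the point `q` removed. Only its behaviour on
holomorphic maps from the plane is recorded. -/
structure IsChart (κ : OnePoint ℂ → ℂ) (q : OnePoint ℂ) : Prop where
  continuousAt : ∀ p, p ≠ q → ContinuousAt κ p
  injOn : InjOn κ {q}ᶜ
  differentiableAt : ∀ {h : ℂ → OnePoint ℂ} {U : Set ℂ} {z : ℂ}, HolomorphicOn h U → z ∈ U →
    h z ≠ q → DifferentiableAt ℂ (fun w => κ (h w)) z

theorem isChart_coordZero : IsChart coordZero OnePoint.infty where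
  continuousAt p hp := by
    obtain ⟨z, rfl⟩ := OnePoint.ne_infty_iff_exists.1 hp
    exact OnePoint.continuousAt_coe.2 continuousAt_id
  injOn p hp q hq h := by
    obtain ⟨z, rfl⟩ := OnePoint.ne_infty_iff_exists.1 hp
    obtain ⟨w, rfl⟩ := OnePoint.ne_infty_iff_exists.1 hq
    exact congrArg _ h
  differentiableAt hh hz hq := (hh.2 _ hz).1 hq

theorem isChart_coordInfty : IsChart coordInfty ((0 : ℂ) : OnePoint ℂ) where
  continuousAt p hp := by
    induction p using OnePoint.rec with
    | infty =>
      rw [OnePoint.continuousAt_infty', coclosedCompact_eq_cocompact,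
        ← Metric.cobounded_eq_cocompact]
      exact tendsto_inv₀_cobounded
    | coe z => exact OnePoint.continuousAt_coe.2 (continuousAt_inv₀ fun h => hp (by rw [h]))
  injOn p hp q hq h := by
    induction p using OnePoint.rec with
    | infty =>
      induction q using OnePoint.rec with
      | infty => rfl
      | coe w => exact absurd (congrArg _ (inv_eq_zero.1 h.symm)) hq
    | coe z =>
      induction q using OnePoint.rec with
      | infty => exact absurd (congrArg _ (inv_eq_zero.1 h)) hp
      | coe w => exact congrArg _ (inv_injective h)
  differentiableAt hh hz hq := (hh.2 _ hz).2 hq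

theorem IsChart.continuousOn_comp {X : Type*} [TopologicalSpace X] {κ : OnePoint ℂ → ℂ}
    {q : OnePoint ℂ} (hκ : IsChart κ q) {h : X → OnePoint ℂ} {K : Set X} (hh : ContinuousOn h K)
    (hq : ∀ w ∈ K, h w ≠ q) : ContinuousOn (fun w => κ (h w)) K :=
  fun w hw => (hκ.continuousAt _ (hq w hw)).comp_continuousWithinAt (hh w hw)

theorem exists_isChart (p : OnePoint ℂ) : ∃ κ q, IsChart κ q ∧ p ≠ q := by
  by_cases hp : p = OnePoint.infty
  · exact ⟨_, _, isChart_coordInfty, by rw [hp]; exact OnePoint.infty_ne_coe _⟩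
  · exact ⟨_, _, isChart_coordZero, hp⟩

theorem holomorphicOn_const (p : OnePoint ℂ) (U : Set ℂ) : HolomorphicOn (fun _ => p) U :=
  ⟨continuousOn_const, fun _ _ =>
    ⟨fun _ => differentiableAt_const _, fun _ => differentiableAt_const _⟩⟩

namespace HolomorphicOn

variable {h : ℂ → OnePoint ℂ} {U V : Set ℂ} {κ : OnePoint ℂ → ℂ} {q : OnePoint ℂ}

theorem mono (hh : HolomorphicOn h U) (hV : V ⊆ U) : HolomorphicOn h V :=
  ⟨hh.1.mono hV, fun z hz => hh.2 z (hV hz)⟩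

theorem comp {ψ : ℂ → ℂ} (hh : HolomorphicOn h U) (hψ : ∀ z ∈ V, DifferentiableAt ℂ ψ z)
    (hm : MapsTo ψ V U) : HolomorphicOn (fun z => h (ψ z)) V :=
  ⟨hh.1.comp (fun z hz => (hψ z hz).continuousAt.continuousWithinAt) hm, fun z hz =>
    ⟨fun hq => ((hh.2 _ (hm hz)).1 hq).comp z (hψ z hz),
      fun hq => ((hh.2 _ (hm hz)).2 hq).comp z (hψ z hz)⟩⟩

theorem continuousAt (hh : HolomorphicOn h U) {z : ℂ} (hU : U ∈ 𝓝 z) : ContinuousAt h z :=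
  hh.1.continuousAt hU

theorem differentiableOn_chart (hh : HolomorphicOn h U) (hκ : IsChart κ q)
    (hq : ∀ z ∈ U, h z ≠ q) : DifferentiableOn ℂ (fun w => κ (h w)) U :=
  fun z hz => (hκ.differentiableAt hh hz (hq z hz)).differentiableWithinAt

theorem diffContOnCl_chart {z : ℂ} {r : ℝ} (hh : HolomorphicOn h (Metric.closedBall z r))
    (hκ : IsChart κ q) (hq : ∀ w ∈ Metric.closedBall z r, h w ≠ q) :
    DiffContOnCl ℂ (fun w => κ (h w)) (Metric.ball z r) :=
  (hh.differentiableOn_chart hκ hq).diffContOnCl_ball subset_rfl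

theorem eventually_eq_or_eventually_ne (hh : HolomorphicOn h U) {z : ℂ} (hU : U ∈ 𝓝 z)
    (p : OnePoint ℂ) : (∀ᶠ w in 𝓝 z, h w = p) ∨ ∀ᶠ w in 𝓝[≠] z, h w ≠ p := by
  have hcz := hh.continuousAt hU
  by_cases hzp : h z = p
  · obtain ⟨κ, q, hκ, hq⟩ := exists_isChart p
    have hev : ∀ᶠ w in 𝓝 z, w ∈ U ∧ h w ≠ q :=
      (eventually_mem_set.2 hU).and (hcz.eventually_ne (hzp ▸ hq))
    have han : AnalyticAt ℂ (fun w => κ (h w)) z := by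
      rw [Complex.analyticAt_iff_eventually_differentiableAt]
      filter_upwards [hev] with w hw using hκ.differentiableAt hh hw.1 hw.2
    refine (han.eventually_eq_or_eventually_ne (analyticAt_const (v := κ p))).imp
      (fun heq => ?_) fun hne => hne.mono fun w hw h_eq => hw (congrArg κ h_eq)
    filter_upwards [heq, hev] with w hw hw' using hκ.injOn hw'.2 hq hw
  · exact .inr ((hcz.eventually_ne hzp).filter_mono nhdsWithin_le_nhds)

theorem const_or_eventually_ne (hh : HolomorphicOn h U) (hU : IsOpen U) (hUc : IsPreconnected U)
    (p : OnePoint ℂ) : (∀ z ∈ U, h z = p) ∨ ∀ z ∈ U, ∀ᶠ w in 𝓝[≠] z, h w ≠ p := by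
  have hdisj : Disjoint {z | ∀ᶠ w in 𝓝 z, h w = p} {z | ∀ᶠ w in 𝓝[≠] z, h w ≠ p} :=
    disjoint_left.2 fun z hz hz' => by
      obtain ⟨w, hw, hw'⟩ := ((hz.filter_mono nhdsWithin_le_nhds).and hz').exists
      exact hw' hw
  refine (hUc.subset_or_subset isOpen_setOfPred_eventually_nhds
    isOpen_setOfPred_eventually_nhdsWithin hdisj fun z hz =>
      hh.eventually_eq_or_eventually_ne (hU.mem_nhds hz) p).imp_left fun hsub z hz => ?_
  exact (hsub hz).self_of_nhds

end HolomorphicOn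

section Hurwitz

variable {ι : Type*} {l : Filter ι} {U : Set ℂ}

theorem IsChart.eventually_ne_and_tendstoUniformlyOn {κ : OnePoint ℂ → ℂ} {q : OnePoint ℂ}
    (hκ : IsChart κ q) {u : ι → ℂ → OnePoint ℂ} {h : ℂ → OnePoint ℂ} (hU : IsOpen U)
    (hl : TendstoLocallyUniformlyOn u h l U) (hc : ContinuousOn h U) {K : Set ℂ} (hK : IsCompact K)
    (hKU : K ⊆ U) (hq : ∀ w ∈ K, h w ≠ q) :
    (∀ᶠ i in l, ∀ w ∈ K, u i w ≠ q) ∧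
      TendstoUniformlyOn (fun i w => κ (u i w)) (fun w => κ (h w)) l K :=
  tendstoUniformlyOn_comp_of_isCompact isOpen_compl_singleton
    (fun p hp => (hκ.continuousAt p hp).continuousWithinAt) hK (hc.mono hKU) hq
    ((tendstoLocallyUniformlyOn_iff_forall_isCompact hU).1 hl K hKU hK)

theorem HolomorphicOn.of_tendstoLocallyUniformlyOn [l.NeBot] {u : ι → ℂ → OnePoint ℂ}
    {h : ℂ → OnePoint ℂ} (hU : IsOpen U) (hu : ∀ᶠ i in l, HolomorphicOn (u i) U)
    (hl : TendstoLocallyUniformlyOn u h l U) : HolomorphicOn h U := by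
  have hc : ContinuousOn h U := hl.continuousOn (hu.mono fun i hi => hi.1).frequently
  have hchart : ∀ {κ q}, IsChart κ q → ∀ z ∈ U, h z ≠ q →
      DifferentiableAt ℂ (fun w => κ (h w)) z := by
    intro κ q hκ z hz hq
    obtain ⟨r, hr, hball⟩ := Metric.nhds_basis_closedBall.mem_iff.1 ((hU.eventually_mem hz).and
      ((hc.continuousAt (hU.mem_nhds hz)).eventually_ne hq))
    have hballU : Metric.closedBall z r ⊆ U := fun w hw => (hball hw).1
    obtain ⟨hne, ht⟩ := hκ.eventually_ne_and_tendstoUniformlyOn hU hl hc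
      (isCompact_closedBall z r) hballU fun w hw => (hball hw).2
    have hd : DifferentiableOn ℂ (fun w => κ (h w)) (Metric.ball z r) := by
      refine (ht.mono Metric.ball_subset_closedBall).tendstoLocallyUniformlyOn.differentiableOn ?_
        Metric.isOpen_ball
      filter_upwards [hu, hne] with i hi hi'
      exact (hi.mono (Metric.ball_subset_closedBall.trans hballU)).differentiableOn_chart hκ
        fun w hw => hi' w (Metric.ball_subset_closedBall hw)
    exact hd.differentiableAt (Metric.ball_mem_nhds z hr)
  exact ⟨hc, fun z hz => ⟨hchart isChart_coordZero z hz, hchart isChart_coordInfty z hz⟩⟩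

theorem eventually_exists_eq_of_tendstoLocallyUniformlyOn {u v : ι → ℂ → OnePoint ℂ}
    {u₀ v₀ : ℂ → OnePoint ℂ} (hU : IsOpen U)
    (hu : ∀ᶠ i in l, HolomorphicOn (u i) U) (hv : ∀ᶠ i in l, HolomorphicOn (v i) U)
    (hul : TendstoLocallyUniformlyOn u u₀ l U) (hvl : TendstoLocallyUniformlyOn v v₀ l U)
    (hu₀ : ContinuousOn u₀ U) (hv₀ : ContinuousOn v₀ U) {z : ℂ} (hz : z ∈ U) (heq : u₀ z = v₀ z)
    (hne : ∀ᶠ w in 𝓝[≠] z, u₀ w ≠ v₀ w) {r : ℝ} (hr : 0 < r) :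
    ∀ᶠ i in l, ∃ w ∈ Metric.ball z r, w ∈ U ∧ u i w = v i w := by
  obtain ⟨κ, q, hκ, hq⟩ := exists_isChart (u₀ z)
  have hUz := hU.mem_nhds hz
  obtain ⟨s, hs, hball⟩ := Metric.nhds_basis_closedBall.mem_iff.1
    ((Metric.isOpen_ball.eventually_mem (Metric.mem_ball_self hr)).and <|
      (hU.eventually_mem hz).and <| ((hu₀.continuousAt hUz).eventually_ne hq).and <|
      ((hv₀.continuousAt hUz).eventually_ne (heq ▸ hq)).and (eventually_nhdsWithin_iff.1 hne))
  have hsr : Metric.closedBall z s ⊆ Metric.ball z r := fun w hw => (hball hw).1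
  have hsU : Metric.closedBall z s ⊆ U := fun w hw => (hball hw).2.1
  have hu₀q : ∀ w ∈ Metric.closedBall z s, u₀ w ≠ q := fun w hw => (hball hw).2.2.1
  have hv₀q : ∀ w ∈ Metric.closedBall z s, v₀ w ≠ q := fun w hw => (hball hw).2.2.2.1
  have hne' : ∀ w ∈ Metric.closedBall z s, w ≠ z → u₀ w ≠ v₀ w := fun w hw => (hball hw).2.2.2.2
  obtain ⟨huq, hut⟩ := hκ.eventually_ne_and_tendstoUniformlyOn hU hul hu₀
    (isCompact_closedBall z s) hsU hu₀q
  obtain ⟨hvq, hvt⟩ := hκ.eventually_ne_and_tendstoUniformlyOn hU hvl hv₀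
    (isCompact_closedBall z s) hsU hv₀q
  have hzero := eventually_exists_zero_of_tendstoUniformlyOn (l := l)
    (F := fun i w => κ (u i w) - κ (v i w)) (F₀ := fun w => κ (u₀ w) - κ (v₀ w)) hs
    (by filter_upwards [hu, hv, huq, hvq] with i hui hvi huqi hvqi
          using ((hui.mono hsU).diffContOnCl_chart hκ huqi).sub
            ((hvi.mono hsU).diffContOnCl_chart hκ hvqi))
    (hut.sub hvt) (((hκ.continuousOn_comp (hu₀.mono hsU) hu₀q).sub
      (hκ.continuousOn_comp (hv₀.mono hsU) hv₀q)).mono Metric.sphere_subset_closedBall)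
    (fun w hw h => by
      have hw' := Metric.sphere_subset_closedBall hw
      exact hne' w hw' (Metric.ne_of_mem_sphere hw hs.ne')
        (hκ.injOn (hu₀q w hw') (hv₀q w hw') (sub_eq_zero.1 h)))
    (by rw [heq, sub_self])
  filter_upwards [hzero, huq, hvq] with i ⟨w, hw, hwz⟩ huqi hvqi
  have hw' := Metric.ball_subset_closedBall hw
  exact ⟨w, hsr hw', hsU hw', hκ.injOn (huqi w hw') (hvqi w hw') (sub_eq_zero.1 hwz)⟩

theorem HolomorphicOn.isOpen_image {h : ℂ → OnePoint ℂ} (hh : HolomorphicOn h U)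
    (hi : InjOn h U) (hU : IsOpen U) : IsOpen (h '' U) := by
  rw [isOpen_iff_mem_nhds]
  rintro _ ⟨z, hz, rfl⟩
  have hsol := eventually_exists_eq_of_tendstoLocallyUniformlyOn (l := 𝓝 (h z)) (u := fun _ => h)
    (v := fun p _ => p) hU (.of_forall fun _ => hh) (.of_forall fun p => holomorphicOn_const p U)
    (fun s hs x _ => ⟨univ, univ_mem, .of_forall fun _ _ _ => refl_mem_uniformity hs⟩)
    (tendsto_id.tendstoUniformlyOn_const U).tendstoLocallyUniformlyOn hh.1 continuousOn_const hz rfl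
    (eventually_nhdsNE_ne_of_injOn (hU.mem_nhds hz) hi) one_pos
  filter_upwards [hsol] with p ⟨w, _, hw, hwp⟩ using ⟨w, hw, hwp⟩

theorem injOn_or_const_of_tendstoLocallyUniformlyOn [l.NeBot] {u : ι → ℂ → OnePoint ℂ}
    {h : ℂ → OnePoint ℂ} (hU : IsOpen U) (hUc : IsPreconnected U)
    (hu : ∀ᶠ i in l, HolomorphicOn (u i) U) (hi : ∀ᶠ i in l, InjOn (u i) U)
    (hl : TendstoLocallyUniformlyOn u h l U) : InjOn h U ∨ ∃ p, ∀ z ∈ U, h z = p := by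
  have hh := HolomorphicOn.of_tendstoLocallyUniformlyOn hU hu hl
  refine or_iff_not_imp_right.2 fun hconst z hz w hw hzw => ?_
  by_contra hne
  have hiso := (hh.const_or_eventually_ne hU hUc (h w)).resolve_left fun h' => hconst ⟨_, h'⟩
  have hsol := eventually_exists_eq_of_tendstoLocallyUniformlyOn hU hu
    (.of_forall fun i => holomorphicOn_const (u i w) U) hl
    ((hl.tendsto_at hw).tendstoUniformlyOn_const U).tendstoLocallyUniformlyOn hh.1
    continuousOn_const hz hzw (hiso z hz) (dist_pos.2 hne)
  obtain ⟨i, ⟨x, hx, hxU, hxw⟩, hinj⟩ := (hsol.and hi).exists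
  rw [hinj hxU hw hxw, Metric.mem_ball, dist_comm] at hx
  exact lt_irrefl _ hx

end Hurwitz

/-! ### Homogeneous coordinates and the chordal metric -/

/-- Homogeneous coordinates of a point of the sphere, normalized to be `(z, 1)` or `(1, 0)`. -/
noncomputable def lift (p : OnePoint ℂ) : ℂ × ℂ := p.elim (1, 0) fun z => (z, 1)

@[simp] theorem lift_coe (z : ℂ) : lift (z : OnePoint ℂ) = (z, 1) := rfl

@[simp] theorem lift_infty : lift OnePoint.infty = (1, 0) := rfl

/-- The determinant of the homogeneous coordinates of two points of the sphere, which measures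
their distance and is a global substitute for `p - q`. -/
noncomputable def wedge (p q : OnePoint ℂ) : ℂ := (lift p).1 * (lift q).2 - (lift p).2 * (lift q).1

/-- The Hermitian norm of the homogeneous coordinates. -/
noncomputable def liftNorm (p : OnePoint ℂ) : ℝ := √(‖(lift p).1‖ ^ 2 + ‖(lift p).2‖ ^ 2)

theorem liftNorm_sq (p : OnePoint ℂ) :
    liftNorm p ^ 2 = ‖(lift p).1‖ ^ 2 + ‖(lift p).2‖ ^ 2 :=
  Real.sq_sqrt (by positivity)

theorem liftNorm_pos (p : OnePoint ℂ) : 0 < liftNorm p := by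
  refine Real.sqrt_pos.2 ?_
  induction p using OnePoint.rec with
  | infty => simp
  | coe z => simp only [lift_coe, norm_one]; positivity

theorem dist_sq_eq (p q : OnePoint ℂ) : dist p q ^ 2 =
    ‖(stereo p).fst - (stereo q).fst‖ ^ 2 + ((stereo p).snd - (stereo q).snd) ^ 2 := by
  have h : dist p q = dist (stereo p) (stereo q) := rfl
  rw [h, WithLp.prod_dist_eq_of_L2, Real.sq_sqrt (by positivity), dist_eq_norm, Real.dist_eq,
    sq_abs]

theorem dist_coe_infty_sq (z : ℂ) :
    dist (z : OnePoint ℂ) OnePoint.infty ^ 2 = 4 / (1 + ‖z‖ ^ 2) := by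
  have hz : (1 + ‖z‖ ^ 2 : ℝ) ≠ 0 := by positivity
  simp only [dist_sq_eq, stereo, OnePoint.elim_some, OnePoint.elim_infty, WithLp.toLp_fst,
    WithLp.toLp_snd, sub_zero, norm_smul, mul_pow, Real.norm_eq_abs, sq_abs]
  field_simp
  ring

theorem dist_coe_coe_sq (z w : ℂ) :
    dist (z : OnePoint ℂ) (w : OnePoint ℂ) ^ 2 =
      4 * ‖z - w‖ ^ 2 / ((1 + ‖z‖ ^ 2) * (1 + ‖w‖ ^ 2)) := by
  have hz : (1 + ‖z‖ ^ 2 : ℝ) ≠ 0 := by positivity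
  have hw : (1 + ‖w‖ ^ 2 : ℝ) ≠ 0 := by positivity
  simp only [dist_sq_eq, stereo, OnePoint.elim_some, WithLp.toLp_fst, WithLp.toLp_snd]
  simp only [Complex.sq_norm, Complex.normSq_apply, Complex.sub_re, Complex.sub_im,
    Complex.smul_re, Complex.smul_im, smul_eq_mul] at hz hw ⊢
  field_simp
  ring

theorem dist_eq_wedge (p q : OnePoint ℂ) :
    dist p q = 2 * ‖wedge p q‖ / (liftNorm p * liftNorm q) := by
  have hp := liftNorm_pos p
  have hq := liftNorm_pos q
  rw [← sq_eq_sq₀ dist_nonneg (by positivity), div_pow, mul_pow, mul_pow, liftNorm_sq, liftNorm_sq]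
  induction p using OnePoint.rec with
  | infty =>
    induction q using OnePoint.rec with
    | infty => simp [wedge]
    | coe w =>
      rw [dist_comm, dist_coe_infty_sq]
      norm_num [wedge, add_comm]
  | coe z =>
    induction q using OnePoint.rec with
    | infty =>
      rw [dist_coe_infty_sq]
      norm_num [wedge, add_comm]
    | coe w =>
      rw [dist_coe_coe_sq]
      norm_num [wedge, add_comm]

theorem wedge_ne_zero_iff {p q : OnePoint ℂ} : wedge p q ≠ 0 ↔ p ≠ q := by
  have h := (mul_pos (liftNorm_pos p) (liftNorm_pos q)).ne'
  rw [← dist_ne_zero (x := p), dist_eq_wedge]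
  simp [h]

theorem dist_le_two (p q : OnePoint ℂ) : dist p q ≤ 2 := by
  have hp := liftNorm_pos p
  have hq := liftNorm_pos q
  rw [dist_eq_wedge, div_le_iff₀ (by positivity)]
  refine mul_le_mul_of_nonneg_left ?_ two_pos.le
  rw [← sq_le_sq₀ (norm_nonneg _) (by positivity), mul_pow, liftNorm_sq, liftNorm_sq]
  have htri := norm_sub_le ((lift p).1 * (lift q).2) ((lift p).2 * (lift q).1)
  rw [norm_mul, norm_mul] at htri
  refine (pow_le_pow_left₀ (norm_nonneg _) htri 2).trans ?_
  nlinarith [sq_nonneg (‖(lift p).1‖ * ‖(lift q).1‖ - ‖(lift p).2‖ * ‖(lift q).2‖)]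

theorem wedge_plucker (p q a b : OnePoint ℂ) :
    wedge p a * wedge q b - wedge p b * wedge q a = wedge p q * wedge a b := by
  simp only [wedge]
  ring

theorem wedge_eq_coordZero {p : OnePoint ℂ} (hp : p ≠ OnePoint.infty) (q : OnePoint ℂ) :
    wedge p q = coordZero p * (lift q).2 - (lift q).1 := by
  obtain ⟨z, rfl⟩ := OnePoint.ne_infty_iff_exists.1 hp
  simp [wedge]

theorem exists_wedge_eq_mul_coordInfty {p : OnePoint ℂ} (hp : p ≠ ((0 : ℂ) : OnePoint ℂ)) :
    ∃ c ≠ 0, ∀ q, wedge p q = c * ((lift q).2 - coordInfty p * (lift q).1) := by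
  induction p using OnePoint.rec with
  | infty => exact ⟨1, one_ne_zero, fun q => by simp [wedge]⟩
  | coe z =>
    have hz : z ≠ 0 := fun h => hp (by rw [h])
    refine ⟨z, hz, fun q => ?_⟩
    rw [wedge, lift_coe, coordInfty_coe, mul_sub, ← mul_assoc, mul_inv_cancel₀ hz]

/-! ### Univalent maps to the sphere omitting two points -/

/-- The Möbius coordinate with zero `a` and pole `b` (junk value `0` at `b`), which turns maps
omitting `a` and `b` into nowhere vanishing functions. -/
noncomputable def moebius (a b p : OnePoint ℂ) : ℂ := wedge p a / wedge p b

section Moebius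

variable {a b p q : OnePoint ℂ}

theorem moebius_ne_zero (ha : p ≠ a) (hb : p ≠ b) : moebius a b p ≠ 0 :=
  div_ne_zero (wedge_ne_zero_iff.2 ha) (wedge_ne_zero_iff.2 hb)

theorem moebius_sub_moebius (hp : p ≠ b) (hq : q ≠ b) :
    moebius a b p - moebius a b q = wedge p q * wedge a b / (wedge p b * wedge q b) := by
  rw [← wedge_plucker, moebius, moebius,
    div_sub_div _ _ (wedge_ne_zero_iff.2 hp) (wedge_ne_zero_iff.2 hq)]

theorem injOn_moebius (hab : a ≠ b) : InjOn (moebius a b) {b}ᶜ := by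
  intro p hp q hq h
  by_contra hne
  refine absurd (sub_eq_zero.2 h) ?_
  rw [moebius_sub_moebius hp hq]
  exact div_ne_zero (mul_ne_zero (wedge_ne_zero_iff.2 hne) (wedge_ne_zero_iff.2 hab))
    (mul_ne_zero (wedge_ne_zero_iff.2 hp) (wedge_ne_zero_iff.2 hq))

theorem dist_mul_dist_mul_norm_moebius_le (hp : p ≠ b) (hq : q ≠ b) :
    dist p q * dist a b * ‖moebius a b q‖ ≤ 4 * ‖moebius a b p - moebius a b q‖ := by
  have hpn := (liftNorm_pos p).ne'
  have hqn := (liftNorm_pos q).ne'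
  have han := (liftNorm_pos a).ne'
  have hbn := (liftNorm_pos b).ne'
  have hpb := norm_ne_zero_iff.2 (wedge_ne_zero_iff.2 hp)
  have hqb := norm_ne_zero_iff.2 (wedge_ne_zero_iff.2 hq)
  calc dist p q * dist a b * ‖moebius a b q‖
      = dist p b * dist q a * ‖moebius a b p - moebius a b q‖ := by
        rw [moebius_sub_moebius hp hq, moebius]
        simp only [dist_eq_wedge, norm_mul, norm_div]
        field_simp
    _ ≤ 2 * 2 * ‖moebius a b p - moebius a b q‖ := by gcongr <;> exact dist_le_two _ _
    _ = 4 * ‖moebius a b p - moebius a b q‖ := by norm_num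

namespace HolomorphicOn

theorem differentiableOn_moebius {h : ℂ → OnePoint ℂ} {U : Set ℂ} (hU : IsOpen U)
    (hh : HolomorphicOn h U) (hb : ∀ z ∈ U, h z ≠ b) :
    DifferentiableOn ℂ (fun z => moebius a b (h z)) U := by
  intro z hz
  refine DifferentiableAt.differentiableWithinAt ?_
  have hcz := hh.continuousAt (hU.mem_nhds hz)
  have hzb := wedge_ne_zero_iff.2 (hb z hz)
  by_cases hzi : h z = OnePoint.infty
  · have hz0 : h z ≠ ((0 : ℂ) : OnePoint ℂ) := hzi ▸ OnePoint.infty_ne_coe _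
    have hd := (hh.2 z hz).2 hz0
    have hev : (fun w => moebius a b (h w)) =ᶠ[𝓝 z] fun w =>
        ((lift a).2 - coordInfty (h w) * (lift a).1) /
          ((lift b).2 - coordInfty (h w) * (lift b).1) := by
      filter_upwards [hcz.eventually_ne hz0] with w hw
      obtain ⟨c, hc, hwedge⟩ := exists_wedge_eq_mul_coordInfty hw
      rw [moebius, hwedge, hwedge, mul_div_mul_left _ _ hc]
    obtain ⟨c, -, hwedge⟩ := exists_wedge_eq_mul_coordInfty hz0
    rw [hwedge] at hzb
    exact (((hd.mul_const _).const_sub _).fun_div ((hd.mul_const _).const_sub _)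
      (right_ne_zero_of_mul hzb)).congr_of_eventuallyEq hev
  · have hd := (hh.2 z hz).1 hzi
    have hev : (fun w => moebius a b (h w)) =ᶠ[𝓝 z] fun w =>
        (coordZero (h w) * (lift a).2 - (lift a).1) /
          (coordZero (h w) * (lift b).2 - (lift b).1) := by
      filter_upwards [hcz.eventually_ne hzi] with w hw
      rw [moebius, wedge_eq_coordZero hw, wedge_eq_coordZero hw]
    rw [wedge_eq_coordZero hzi] at hzb
    exact (((hd.mul_const _).sub_const _).fun_div ((hd.mul_const _).sub_const _)
      hzb).congr_of_eventuallyEq hev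

theorem dist_le_of_injOn_of_omits {h : ℂ → OnePoint ℂ} {z : ℂ} {R δ : ℝ} (hR : 0 < R)
    (hh : HolomorphicOn h (Metric.ball z (2 * R))) (hi : InjOn h (Metric.ball z (2 * R)))
    (hδ : 0 < δ) (hab : δ ≤ dist a b) (ha : ∀ w ∈ Metric.ball z (2 * R), h w ≠ a)
    (hb : ∀ w ∈ Metric.ball z (2 * R), h w ≠ b) {x y : ℂ}
    (hx : x ∈ Metric.ball z (R / 800)) (hy : y ∈ Metric.ball z (R / 800)) :
    dist (h x) (h y) ≤ 3200 / (δ * R) * ‖x - y‖ := by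
  have hsub : Metric.ball z (R / 800) ⊆ Metric.ball z (2 * R) :=
    Metric.ball_subset_ball (by linarith)
  have hlip := norm_sub_le_of_injOn_of_ne_zero (F := fun z => moebius a b (h z)) hR
    (hh.differentiableOn_moebius Metric.isOpen_ball hb)
    (fun w hw => moebius_ne_zero (ha w hw) (hb w hw))
    (fun v hv w hw hvw =>
      hi hv hw (injOn_moebius (dist_pos.1 (hδ.trans_le hab)) (hb v hv) (hb w hw) hvw)) hx hy
  have hpos : 0 < ‖moebius a b (h y)‖ :=
    norm_pos_iff.2 (moebius_ne_zero (ha y (hsub hy)) (hb y (hsub hy)))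
  have hprod : dist (h x) (h y) * dist a b ≤ 3200 / R * ‖x - y‖ := by
    refine le_of_mul_le_mul_right ?_ hpos
    calc dist (h x) (h y) * dist a b * ‖moebius a b (h y)‖
        ≤ 4 * ‖moebius a b (h x) - moebius a b (h y)‖ :=
          dist_mul_dist_mul_norm_moebius_le (hb x (hsub hx)) (hb y (hsub hy))
      _ ≤ 4 * (800 / R * ‖x - y‖ * ‖moebius a b (h y)‖) := by gcongr
      _ = 3200 / R * ‖x - y‖ * ‖moebius a b (h y)‖ := by ring
  calc dist (h x) (h y) = dist (h x) (h y) * δ / δ := by field_simp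
    _ ≤ dist (h x) (h y) * dist a b / δ := by gcongr
    _ ≤ 3200 / R * ‖x - y‖ / δ := by gcongr
    _ = 3200 / (δ * R) * ‖x - y‖ := by field_simp

end HolomorphicOn

end Moebius

/-! ### Holomorphic self-maps of the sphere -/

theorem ratio_of_ne {a b : ℂ} (hb : b ≠ 0) : ratio a b = ((a / b : ℂ) : OnePoint ℂ) := if_neg hb

@[simp] theorem ratio_zero_right (a : ℂ) : ratio a 0 = OnePoint.infty := if_pos rfl

@[simp] theorem ratio_one_right (a : ℂ) : ratio a 1 = (a : OnePoint ℂ) := by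
  rw [ratio_of_ne one_ne_zero, div_one]

theorem ratio_eq_infty_iff {a b : ℂ} : ratio a b = OnePoint.infty ↔ b = 0 := by
  by_cases hb : b = 0
  · simp [hb]
  · simp [ratio_of_ne hb, hb]

theorem ratio_eq_coe_iff {a b c : ℂ} (h : b = 0 → a ≠ 0) : ratio a b = c ↔ a = c * b := by
  by_cases hb : b = 0
  · simp [hb, h hb]
  · rw [ratio_of_ne hb, OnePoint.coe_eq_coe, div_eq_iff hb]

theorem ratio_mul_left {c : ℂ} (hc : c ≠ 0) (a b : ℂ) : ratio (c * a) (c * b) = ratio a b := by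
  by_cases hb : b = 0
  · simp [hb]
  · rw [ratio_of_ne hb, ratio_of_ne (mul_ne_zero hc hb), mul_div_mul_left _ _ hc]

theorem coordZero_ratio (a b : ℂ) : coordZero (ratio a b) = a / b := by
  by_cases hb : b = 0
  · rw [hb, ratio_zero_right, div_zero]
    rfl
  · rw [ratio_of_ne hb, coordZero_coe]

theorem coordInfty_ratio (a b : ℂ) : coordInfty (ratio a b) = b / a := by
  by_cases hb : b = 0
  · rw [hb, ratio_zero_right, coordInfty_infty, zero_div]
  · rw [ratio_of_ne hb, coordInfty_coe, inv_div]

theorem exists_eq_smul_lift_ratio {a b : ℂ} (h : b = 0 → a ≠ 0) :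
    ∃ c : ℂ, c ≠ 0 ∧ (a, b) = c • lift (ratio a b) := by
  by_cases hb : b = 0
  · exact ⟨a, h hb, by simp [hb]⟩
  · exact ⟨b, hb, by simp [ratio_of_ne hb, mul_div_cancel₀ _ hb]⟩

theorem dist_ratio_ratio {a b c d : ℂ} (hab : b = 0 → a ≠ 0) (hcd : d = 0 → c ≠ 0) :
    dist (ratio a b) (ratio c d) =
      2 * ‖a * d - b * c‖ / (√(‖a‖ ^ 2 + ‖b‖ ^ 2) * √(‖c‖ ^ 2 + ‖d‖ ^ 2)) := by
  have hscale : ∀ (k : ℂ) (p : OnePoint ℂ),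
      √(‖k * (lift p).1‖ ^ 2 + ‖k * (lift p).2‖ ^ 2) = ‖k‖ * liftNorm p := fun k p => by
    rw [norm_mul, norm_mul, mul_pow, mul_pow, ← mul_add, Real.sqrt_mul (by positivity),
      Real.sqrt_sq (norm_nonneg k), liftNorm]
  obtain ⟨k, hk, hkab⟩ := exists_eq_smul_lift_ratio hab
  obtain ⟨m, hm, hmcd⟩ := exists_eq_smul_lift_ratio hcd
  obtain ⟨ha, hb⟩ := Prod.ext_iff.1 hkab
  obtain ⟨hc, hd⟩ := Prod.ext_iff.1 hmcd
  generalize ratio a b = p at *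
  generalize ratio c d = q at *
  simp only [Prod.smul_fst, Prod.smul_snd, smul_eq_mul] at ha hb hc hd
  have hp := (liftNorm_pos p).ne'
  have hq := (liftNorm_pos q).ne'
  have hk' := norm_ne_zero_iff.2 hk
  have hm' := norm_ne_zero_iff.2 hm
  have hwedge : a * d - b * c = k * m * wedge p q := by
    rw [ha, hb, hc, hd, wedge]
    ring
  rw [hwedge, ha, hb, hc, hd, hscale, hscale, dist_eq_wedge, norm_mul, norm_mul]
  field_simp

theorem holomorphicOn_ratio {P Q : ℂ → ℂ} (hP : Differentiable ℂ P) (hQ : Differentiable ℂ Q)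
    (h : ∀ z, Q z = 0 → P z ≠ 0) : HolomorphicOn (fun w => ratio (P w) (Q w)) univ := by
  refine ⟨?_, fun z _ => ?_⟩
  · rw [continuousOn_univ, continuous_iff_continuousAt]
    intro z
    have hne : ∀ w, √(‖P w‖ ^ 2 + ‖Q w‖ ^ 2) ≠ 0 := fun w => Real.sqrt_ne_zero'.2 <| by
      rcases eq_or_ne (Q w) 0 with h0 | h0
      · have := norm_pos_iff.2 (h w h0)
        positivity
      · have := norm_pos_iff.2 h0
        positivity
    rw [ContinuousAt, tendsto_iff_dist_tendsto_zero]
    simp only [dist_ratio_ratio (h _) (h _)]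
    have hcont : Continuous fun w => 2 * ‖P w * Q z - Q w * P z‖ /
        (√(‖P w‖ ^ 2 + ‖Q w‖ ^ 2) * √(‖P z‖ ^ 2 + ‖Q z‖ ^ 2)) := by
      have := hP.continuous
      have := hQ.continuous
      fun_prop (disch := exact fun w => mul_ne_zero (hne w) (hne z))
    simpa [mul_comm] using hcont.tendsto z
  · simp only [coordZero_ratio, coordInfty_ratio]
    refine ⟨fun hz => (hP z).fun_div (hQ z) fun h0 => hz ?_,
      fun hz => (hQ z).fun_div (hP z) fun h0 => hz ?_⟩
    · rw [h0, ratio_zero_right]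
    · rw [h0, ratio_of_ne fun h1 => h z h1 h0, zero_div]

/-- `f` is a holomorphic self-map of the sphere: it is holomorphic in the parametrizations
`z ↦ z` and `w ↦ 1 / w` of the complements of `∞` and `0`. -/
def IsHolomorphic (f : OnePoint ℂ → OnePoint ℂ) : Prop :=
  HolomorphicOn (fun z : ℂ => f z) univ ∧ HolomorphicOn (fun w => f (ratio 1 w)) univ

theorem isHolomorphic_id : IsHolomorphic id := by
  refine ⟨?_, holomorphicOn_ratio (by fun_prop) (by fun_prop) fun _ _ => one_ne_zero⟩
  simpa using holomorphicOn_ratio (P := id) (Q := 1) differentiable_id (differentiable_const 1)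
    fun z h => absurd h one_ne_zero

theorem isHolomorphic_const (p : OnePoint ℂ) : IsHolomorphic fun _ => p :=
  ⟨holomorphicOn_const p _, holomorphicOn_const p _⟩

theorem exists_parametrization (p : OnePoint ℂ) :
    ∃ (χ : ℂ → OnePoint ℂ) (z : ℂ), χ z = p ∧ Function.Injective χ ∧
      ∀ f, IsHolomorphic f → HolomorphicOn (fun w => f (χ w)) univ := by
  induction p using OnePoint.rec with
  | coe z => exact ⟨fun w => w, z, rfl, OnePoint.coe_injective, fun f hf => hf.1⟩
  | infty =>
    refine ⟨ratio 1, 0, ratio_zero_right 1, fun x y hxy => ?_, fun f hf => hf.2⟩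
    simpa [coordInfty_ratio] using congrArg coordInfty hxy

theorem IsHolomorphic.continuous {f : OnePoint ℂ → OnePoint ℂ} (hf : IsHolomorphic f) :
    Continuous f := by
  rw [continuous_iff_continuousAt]
  intro p
  obtain ⟨χ, z, rfl, hinj, hχ⟩ := exists_parametrization p
  have hopen : IsOpenMap χ := fun W hW =>
    ((hχ id isHolomorphic_id).mono (subset_univ W)).isOpen_image hinj.injOn hW
  have hfχ : Tendsto (fun w => f (χ w)) (𝓝 z) (𝓝 (f (χ z))) :=
    (hχ f hf).continuousAt univ_mem
  exact (tendsto_map'_iff.2 hfχ).mono_left (hopen.nhds_le z)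

section Persistence

variable {ι : Type*} {l : Filter ι}

theorem eventually_exists_eq_of_tendstoUniformly {u v : ι → OnePoint ℂ → OnePoint ℂ}
    {u₀ v₀ : OnePoint ℂ → OnePoint ℂ} (hu : ∀ᶠ i in l, IsHolomorphic (u i))
    (hv : ∀ᶠ i in l, IsHolomorphic (v i)) (hul : TendstoUniformly u u₀ l)
    (hvl : TendstoUniformly v v₀ l) (hu₀ : Continuous u₀) (hv₀ : Continuous v₀) {p : OnePoint ℂ}
    (heq : u₀ p = v₀ p) (hne : ∀ᶠ q in 𝓝[≠] p, u₀ q ≠ v₀ q) {V : Set (OnePoint ℂ)}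
    (hV : V ∈ 𝓝 p) : ∀ᶠ i in l, ∃ q ∈ V, u i q = v i q := by
  obtain ⟨χ, z, rfl, hinj, hχ⟩ := exists_parametrization p
  have hχc : Continuous χ := continuousOn_univ.1 (hχ id isHolomorphic_id).1
  have hχne : Tendsto χ (𝓝[≠] z) (𝓝[≠] (χ z)) := tendsto_nhdsWithin_iff.2
    ⟨hχc.continuousWithinAt, eventually_nhdsNE_ne_of_injOn univ_mem hinj.injOn⟩
  obtain ⟨r, hr, hrV⟩ := Metric.mem_nhds_iff.1 (hχc.continuousAt hV)
  filter_upwards [eventually_exists_eq_of_tendstoLocallyUniformlyOn isOpen_univ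
    (hu.mono fun i => hχ _) (hv.mono fun i => hχ _)
    (hul.comp χ).tendstoUniformlyOn.tendstoLocallyUniformlyOn
    (hvl.comp χ).tendstoUniformlyOn.tendstoLocallyUniformlyOn (hu₀.comp hχc).continuousOn
    (hv₀.comp hχc).continuousOn (mem_univ z) heq (hχne.eventually hne) hr] with i ⟨w, hw, _, hw'⟩
  exact ⟨χ w, hrV hw, hw'⟩

variable {f : ι → OnePoint ℂ → OnePoint ℂ} {g : OnePoint ℂ → OnePoint ℂ}

theorem eventually_exists_map_eq_self (hf : ∀ i, IsHolomorphic (f i)) (hg : IsHolomorphic g)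
    (hfg : TendstoUniformly f g l) (hfin : (Function.fixedPoints g).Finite) {a : OnePoint ℂ}
    (ha : g a = a) {V : Set (OnePoint ℂ)} (hV : V ∈ 𝓝 a) :
    ∀ᶠ i in l, ∃ p ∈ V, f i p = p :=
  eventually_exists_eq_of_tendstoUniformly (v := fun _ => id) (.of_forall hf)
    (.of_forall fun _ => isHolomorphic_id) hfg
    (fun _ hs => .of_forall fun _ _ => refl_mem_uniformity hs) hg.continuous continuous_id ha
    (nhdsNE_le_cofinite a hfin.compl_mem_cofinite) hV

theorem eventually_exists_map_eq (hf : ∀ i, IsHolomorphic (f i)) (hg : IsHolomorphic g)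
    (hfg : TendstoUniformly f g l) {a b : OnePoint ℂ} (hfin : {p | g p = a}.Finite)
    (hb : g b = a) {V : Set (OnePoint ℂ)} (hV : V ∈ 𝓝 b) :
    ∀ᶠ x : ι × OnePoint ℂ in l ×ˢ 𝓝 a, ∃ p ∈ V, f x.1 p = x.2 :=
  eventually_exists_eq_of_tendstoUniformly (ι := ι × OnePoint ℂ) (u := fun x => f x.1)
    (v := fun x _ => x.2) (v₀ := fun _ => a) (.of_forall fun x => hf x.1)
    (.of_forall fun x => isHolomorphic_const x.2)
    (fun s hs => tendsto_fst.eventually (hfg s hs))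
    (fun _ hs => (tendsto_snd.eventually (UniformSpace.ball_mem_nhds a hs)).mono fun _ hx _ => hx)
    hg.continuous continuous_const hb (nhdsNE_le_cofinite b hfin.compl_mem_cofinite) hV

end Persistence

/-! ### Rational maps -/

section Polynomial

open Polynomial

variable {p q r : ℂ[X]} {d : ℕ}

theorem eval_ne_zero_of_isCoprime (h : IsCoprime p q) {z : ℂ} (hq : q.eval z = 0) :
    p.eval z ≠ 0 := by
  intro hp
  obtain ⟨a, b, hab⟩ := h
  simpa [hp, hq] using congrArg (eval z) hab

theorem sub_mul_ne_zero_of_isCoprime (h : IsCoprime p q)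
    (hr : r.natDegree < max p.natDegree q.natDegree) : p - r * q ≠ 0 := by
  intro h0
  rw [sub_eq_zero] at h0
  have hq : q.natDegree = 0 :=
    natDegree_eq_zero_of_isUnit (h.isUnit_of_dvd' ⟨r, by rw [h0, mul_comm]⟩ dvd_rfl)
  have hp : p.natDegree ≤ r.natDegree + q.natDegree := h0 ▸ natDegree_mul_le
  omega

theorem eval_reflect (hp : p.natDegree ≤ d) {w : ℂ} (hw : w ≠ 0) :
    (p.reflect d).eval w = w ^ d * p.eval w⁻¹ := by
  let := invertibleOfNonzero (inv_ne_zero hw)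
  have h := eval₂_reflect_mul_pow (RingHom.id ℂ) w⁻¹ d p hp
  rw [invOf_eq_inv, inv_inv] at h
  rw [eval, eval, ← h, inv_pow, mul_left_comm, mul_inv_cancel₀ (pow_ne_zero d hw), mul_one]

theorem eval_zero_reflect (d : ℕ) (p : ℂ[X]) : (p.reflect d).eval 0 = p.coeff d := by
  rw [← coeff_zero_eq_eval_zero, coeff_reflect, revAt_zero]

theorem eq_zero_of_coeff_max_natDegree_eq_zero (hp : p.coeff (max p.natDegree q.natDegree) = 0)
    (hq : q.coeff (max p.natDegree q.natDegree) = 0) : p = 0 ∧ q = 0 := by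
  rcases le_total p.natDegree q.natDegree with h | h
  · rw [max_eq_right h] at hp hq
    have hq0 : q = 0 := leadingCoeff_eq_zero.1 hq
    rw [hq0, natDegree_zero] at h hp
    exact ⟨by rw [eq_C_of_natDegree_le_zero h, hp, C_0], hq0⟩
  · rw [max_eq_left h] at hp hq
    have hp0 : p = 0 := leadingCoeff_eq_zero.1 hp
    rw [hp0, natDegree_zero] at h hq
    exact ⟨hp0, by rw [eq_C_of_natDegree_le_zero h, hq, C_0]⟩

theorem exists_eval_eq_zero (hp : p.natDegree ≠ 0) : ∃ z, p.eval z = 0 :=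
  IsAlgClosed.exists_root p (degree_ne_of_natDegree_ne hp)

theorem eval_derivative_eq_zero_of_unique_root {a : ℂ} (hp : 2 ≤ p.natDegree)
    (h : ∀ z, p.eval z = 0 → z = a) : p.derivative.eval a = 0 := by
  obtain ⟨z, hz⟩ := exists_eval_eq_zero (p := p) (by omega)
  obtain rfl := h z hz
  obtain ⟨r, rfl⟩ := dvd_iff_isRoot.2 hz
  have hr : r.natDegree ≠ 0 := by
    have hdeg := natDegree_mul_le (p := X - C z) (q := r)
    rw [natDegree_X_sub_C] at hdeg
    omega
  obtain ⟨y, hy⟩ := exists_eval_eq_zero hr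
  rw [h y (by simp [hy])] at hy
  simp [hy]

-- The derivatives of `p - X * q` and `p - C a * q` at their multiple root `a` differ by `q(a)`.
theorem eval_eq_zero_of_unique_roots {a : ℂ} (hX : 2 ≤ (p - X * q).natDegree)
    (hXa : ∀ z, (p - X * q).eval z = 0 → z = a) (hC : 2 ≤ (p - C a * q).natDegree)
    (hCa : ∀ z, (p - C a * q).eval z = 0 → z = a) : q.eval a = 0 := by
  have hdX := eval_derivative_eq_zero_of_unique_root hX hXa
  have hdC := eval_derivative_eq_zero_of_unique_root hC hCa
  simp only [derivative_sub, derivative_mul, derivative_X, derivative_C, eval_sub, eval_add,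
    eval_mul, eval_one, eval_X, eval_C, eval_zero] at hdX hdC
  linear_combination hdC - hdX

end Polynomial

theorem finite_of_finite_preimage_coe {s : Set (OnePoint ℂ)}
    (h : {z : ℂ | (z : OnePoint ℂ) ∈ s}.Finite) : s.Finite := by
  refine ((h.image fun z : ℂ => (z : OnePoint ℂ)).union (finite_singleton OnePoint.infty)).subset ?_
  intro p hp
  induction p using OnePoint.rec with
  | infty => exact .inr rfl
  | coe z => exact .inl (mem_image_of_mem _ hp)

namespace IsRationalMap

open Polynomial

variable {d : ℕ} {f : OnePoint ℂ → OnePoint ℂ}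

theorem isHolomorphic (hf : IsRationalMap d f) : IsHolomorphic f := by
  obtain ⟨p, q, hpq, rfl, hf, hinf⟩ := hf
  set d := max p.natDegree q.natDegree
  have hp : p.natDegree ≤ d := le_max_left _ _
  have hq : q.natDegree ≤ d := le_max_right _ _
  have hreflect : ∀ w, f (ratio 1 w) = ratio ((p.reflect d).eval w) ((q.reflect d).eval w) := by
    intro w
    rcases eq_or_ne w 0 with rfl | hw
    · rw [ratio_zero_right, hinf, eval_zero_reflect, eval_zero_reflect]
    · rw [ratio_of_ne hw, hf, one_div, eval_reflect hp hw, eval_reflect hq hw,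
        ratio_mul_left (pow_ne_zero _ hw)]
  simp only [IsHolomorphic, hf, hreflect]
  refine ⟨holomorphicOn_ratio p.differentiable q.differentiable
    fun z => eval_ne_zero_of_isCoprime hpq, holomorphicOn_ratio (Polynomial.differentiable _)
    (Polynomial.differentiable _) fun w hqw hpw => ?_⟩
  rcases eq_or_ne w 0 with rfl | hw
  · rw [eval_zero_reflect] at hqw hpw
    obtain ⟨rfl, rfl⟩ := eq_zero_of_coeff_max_natDegree_eq_zero hpw hqw
    exact not_isCoprime_zero_zero hpq
  · rw [eval_reflect hq hw] at hqw
    rw [eval_reflect hp hw] at hpw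
    exact eval_ne_zero_of_isCoprime hpq ((mul_eq_zero_iff_left (pow_ne_zero d hw)).1 hqw)
      ((mul_eq_zero_iff_left (pow_ne_zero d hw)).1 hpw)

theorem finite_fixedPoints (hd : 2 ≤ d) (hf : IsRationalMap d f) :
    (Function.fixedPoints f).Finite := by
  obtain ⟨p, q, hpq, rfl, hf, -⟩ := hf
  have hne : p - X * q ≠ 0 := sub_mul_ne_zero_of_isCoprime hpq (by rw [natDegree_X]; omega)
  refine finite_of_finite_preimage_coe ((finite_setOfPred_isRoot hne).subset fun z hz => ?_)
  have hz : f z = z := hz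
  rw [hf, ratio_eq_coe_iff (eval_ne_zero_of_isCoprime hpq)] at hz
  simp [hz]

theorem finite_fiber (hd : d ≠ 0) (hf : IsRationalMap d f) (a : OnePoint ℂ) :
    {p | f p = a}.Finite := by
  obtain ⟨p, q, hpq, rfl, hf, -⟩ := hf
  refine finite_of_finite_preimage_coe ?_
  induction a using OnePoint.rec with
  | infty =>
    have hne : q ≠ 0 := by
      rintro rfl
      rw [natDegree_zero, natDegree_eq_zero_of_isUnit (isCoprime_zero_right.1 hpq)] at hd
      exact hd (max_self 0)
    refine (finite_setOfPred_isRoot hne).subset fun z hz => ?_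
    have hz : f z = OnePoint.infty := hz
    rwa [hf, ratio_eq_infty_iff] at hz
  | coe a =>
    have hne : p - C a * q ≠ 0 :=
      sub_mul_ne_zero_of_isCoprime hpq (by rw [natDegree_C]; omega)
    refine (finite_setOfPred_isRoot hne).subset fun z hz => ?_
    have hz : f z = a := hz
    rw [hf, ratio_eq_coe_iff (eval_ne_zero_of_isCoprime hpq)] at hz
    simp [hz]

theorem exists_ne_infty_map_eq (hd : 2 ≤ d) (hf : IsRationalMap d f) :
    ∃ b ≠ OnePoint.infty, f b = OnePoint.infty ∨ f b = b := by
  obtain ⟨p, q, hpq, hmax, hf, -⟩ := hf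
  by_cases hq : q.natDegree = 0
  · have hXq : (X * q).natDegree ≤ 1 := natDegree_mul_le.trans (by rw [natDegree_X, hq])
    have hdeg : (p - X * q).natDegree ≠ 0 := by
      rw [natDegree_sub_eq_left_of_natDegree_lt] <;> omega
    obtain ⟨z, hz⟩ := exists_eval_eq_zero hdeg
    refine ⟨z, OnePoint.coe_ne_infty z, .inr ?_⟩
    rw [hf, ratio_eq_coe_iff (eval_ne_zero_of_isCoprime hpq)]
    simpa [sub_eq_zero] using hz
  · obtain ⟨z, hz⟩ := exists_eval_eq_zero hq
    exact ⟨z, OnePoint.coe_ne_infty z, .inl (by rw [hf, hz, ratio_zero_right])⟩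

theorem exists_fixed_and_preperiodic (hd : 2 ≤ d) (hf : IsRationalMap d f) :
    ∃ a b, a ≠ b ∧ f a = a ∧ (f b = a ∨ f b = b) := by
  by_cases hfix : f OnePoint.infty = OnePoint.infty
  · obtain ⟨b, hb, h⟩ := hf.exists_ne_infty_map_eq hd
    exact ⟨_, b, hb.symm, hfix, h⟩
  obtain ⟨p, q, hpq, hmax, hf, hinf⟩ := hf
  have hval : ∀ {z c : ℂ}, f z = c ↔ p.eval z = c * q.eval z := by
    intro z c
    rw [hf, ratio_eq_coe_iff (eval_ne_zero_of_isCoprime hpq)]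
  have hq0 : q.coeff d ≠ 0 := mt ratio_eq_infty_iff.2 (hinf ▸ hfix)
  have hdeg : (p - X * q).natDegree = d + 1 := by
    have hXq : (X * q).natDegree = d + 1 := by
      rw [natDegree_X_mul (by rintro rfl; simp at hq0),
        le_antisymm (hmax ▸ le_max_right _ _) (le_natDegree_of_ne_zero hq0)]
    rw [natDegree_sub_eq_right_of_natDegree_lt (by omega), hXq]
  obtain ⟨a, ha⟩ := exists_eval_eq_zero (p := p - X * q) (by omega)
  have ha : p.eval a = a * q.eval a := by simpa [sub_eq_zero] using ha
  have hfa : f a = a := hval.2 ha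
  by_contra! H
  have hfixed : ∀ z, (p - X * q).eval z = 0 → z = a := fun z hz => by
    by_contra hne
    exact (H a z (by simpa using Ne.symm hne) hfa).2 (hval.2 (by simpa [sub_eq_zero] using hz))
  have hfiber : ∀ z, (p - C a * q).eval z = 0 → z = a := fun z hz => by
    by_contra hne
    exact (H a z (by simpa using Ne.symm hne) hfa).1 (hval.2 (by simpa [sub_eq_zero] using hz))
  have hdeg' : 2 ≤ (p - C a * q).natDegree := by
    refine hd.trans (le_natDegree_of_ne_zero fun h0 => ?_)
    rw [coeff_sub, coeff_C_mul, sub_eq_zero] at h0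
    refine (H a OnePoint.infty (OnePoint.coe_ne_infty a) hfa).1 ?_
    rwa [hinf, ratio_eq_coe_iff fun h => absurd h hq0]
  have hqa := eval_eq_zero_of_unique_roots (by omega) hfixed hdeg' hfiber
  exact eval_ne_zero_of_isCoprime hpq hqa (by rw [ha, hqa, mul_zero])

end IsRationalMap

/-- Eventually along `l`, the map `f i` has two points whose images are fixed, and these stay a
definite distance apart. Univalent maps omitting such pairs form a normal family. -/
def HasSeparatedPrefixedPoints {ι : Type*} (l : Filter ι) (f : ι → OnePoint ℂ → OnePoint ℂ) :
    Prop :=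
  ∃ δ > 0, ∀ᶠ i in l, ∃ a b, δ ≤ dist a b ∧ f i (f i a) = f i a ∧ f i (f i b) = f i b

theorem IsRationalMap.hasSeparatedPrefixedPoints {ι : Type*} {l : Filter ι}
    {f : ι → OnePoint ℂ → OnePoint ℂ} {g : OnePoint ℂ → OnePoint ℂ} {d : ℕ}
    (hf : ∀ i, IsHolomorphic (f i)) (hd : 2 ≤ d) (hg : IsRationalMap d g)
    (hfg : TendstoUniformly f g l) :
    HasSeparatedPrefixedPoints l f := by
  have hfin := hg.finite_fixedPoints hd
  obtain ⟨a, b, hab, ha, hb⟩ := hg.exists_fixed_and_preperiodic hd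
  have hδ : 0 < dist a b / 3 := div_pos (dist_pos.2 hab) three_pos
  have hVa := Metric.ball_mem_nhds a hδ
  have hVb := Metric.ball_mem_nhds b hδ
  have hsep : ∀ {a' b'}, a' ∈ Metric.ball a (dist a b / 3) → b' ∈ Metric.ball b (dist a b / 3) →
      dist a b / 3 ≤ dist a' b' := by
    intro a' b' ha' hb'
    rw [Metric.mem_ball, dist_comm] at ha' hb'
    linarith [dist_triangle4_right a b a' b']
  refine ⟨dist a b / 3, hδ, ?_⟩
  rcases hb with hb | hb
  · obtain ⟨P, hP, Q, hQ, hPQ⟩ := eventually_prod_iff.1 (eventually_exists_map_eq hf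
      hg.isHolomorphic hfg (hg.finite_fiber (by omega) a) hb hVb)
    filter_upwards [hP, eventually_exists_map_eq_self hf hg.isHolomorphic hfg hfin ha
      (inter_mem hVa hQ)] with i hi ⟨a', ⟨ha', hQa'⟩, hfa'⟩
    obtain ⟨b', hb', hfb'⟩ := hPQ hi hQa'
    exact ⟨a', b', hsep ha' hb', by rw [hfa', hfa'], by rw [hfb', hfa']⟩
  · filter_upwards [eventually_exists_map_eq_self hf hg.isHolomorphic hfg hfin ha hVa,
      eventually_exists_map_eq_self hf hg.isHolomorphic hfg hfin hb hVb]
      with i ⟨a', ha', hfa'⟩ ⟨b', hb', hfb'⟩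
    exact ⟨a', b', hsep ha' hb', by rw [hfa', hfa'], by rw [hfb', hfb']⟩

end RiemannSphere

/-! ### Limits of strip maps -/

theorem tendstoLocallyUniformlyOn_of_eventually_dist_lt {ι X Y : Type*} [TopologicalSpace X]
    [PseudoMetricSpace Y] {l : Filter ι} [l.NeBot] {u : ι → X → Y} {u₀ : X → Y} {W : Set X}
    (hpt : ∀ x ∈ W, Tendsto (fun i => u i x) l (𝓝 (u₀ x)))
    (hequi : ∀ x ∈ W, ∀ ε > 0, ∃ V ∈ 𝓝[W] x, ∀ᶠ i in l, ∀ y ∈ V, dist (u i y) (u i x) < ε) :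
    TendstoLocallyUniformlyOn u u₀ l W := by
  rw [Metric.tendstoLocallyUniformlyOn_iff]
  intro ε hε x hx
  obtain ⟨V, hV, hu⟩ := hequi x hx (ε / 3) (by positivity)
  have hlim : ∀ y ∈ V ∩ W, dist (u₀ y) (u₀ x) ≤ ε / 3 := fun y hy =>
    le_of_tendsto ((hpt y hy.2).dist (hpt x hx)) (hu.mono fun i hi => (hi y hy.1).le)
  refine ⟨V ∩ W, inter_mem hV self_mem_nhdsWithin, ?_⟩
  filter_upwards [hu, Metric.tendsto_nhds.1 (hpt x hx) (ε / 3) (by positivity)] with i hi hix y hy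
  have hux := hi y hy.1
  rw [dist_comm] at hix hux
  linarith [dist_triangle4 (u₀ y) (u₀ x) (u i x) (u i y), hlim y hy]

namespace RiemannSphere

section StandardStrip

variable {L : ℝ} {z : ℂ}

theorem isOpen_standardStrip (L : ℝ) : IsOpen (standardStrip L) :=
  isOpen_lt (continuous_abs.comp Complex.continuous_im) continuous_const

theorem convex_standardStrip (L : ℝ) : Convex ℝ (standardStrip L) := by
  have : standardStrip L = Complex.imLm ⁻¹' Ioo (-L) L := by
    ext z
    exact abs_lt (a := z.im)
  rw [this]
  exact (convex_Ioo (-L) L).linear_preimage _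

theorem standardStrip_mem_nhds (hz : z ∈ standardStrip L) : standardStrip L ∈ 𝓝 z :=
  (isOpen_standardStrip L).mem_nhds hz

theorem ofReal_mem_standardStrip (hL : 0 < L) (x : ℝ) : (x : ℂ) ∈ standardStrip L := by
  simpa [standardStrip] using hL

theorem add_ofReal_mem_standardStrip (hz : z ∈ standardStrip L) (t : ℝ) :
    z + t ∈ standardStrip L := by
  simpa [standardStrip] using hz

theorem sub_one_mem_standardStrip (hz : z ∈ standardStrip L) : z - 1 ∈ standardStrip L := by
  simpa [standardStrip] using hz

end StandardStrip

/-- `h` is a conformal isomorphism of the standard strip to its image that conjugates `z ↦ z - 1`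
to `f`. -/
structure IsStripMap (L : ℝ) (f : OnePoint ℂ → OnePoint ℂ) (h : ℂ → OnePoint ℂ) : Prop where
  holomorphicOn : HolomorphicOn h (standardStrip L)
  injOn : InjOn h (standardStrip L)
  conj : ∀ z ∈ standardStrip L, f (h z) = h (z - 1)

namespace IsStripMap

variable {L : ℝ} {f : OnePoint ℂ → OnePoint ℂ} {h : ℂ → OnePoint ℂ}

theorem translate (hh : IsStripMap L f h) (t : ℝ) : IsStripMap L f fun z => h (z + t) where
  holomorphicOn := hh.holomorphicOn.comp (fun _ _ => by fun_prop)
    fun _ hz => add_ofReal_mem_standardStrip hz t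
  injOn _ hz _ hw h := add_right_cancel (hh.injOn (add_ofReal_mem_standardStrip hz t)
    (add_ofReal_mem_standardStrip hw t) h)
  conj z hz := by rw [hh.conj _ (add_ofReal_mem_standardStrip hz t), add_sub_right_comm]

theorem ne_of_map_map_eq (hh : IsStripMap L f h) {a : OnePoint ℂ} (ha : f (f a) = f a) {z : ℂ}
    (hz : z ∈ standardStrip L) : h z ≠ a := by
  rintro rfl
  have hz1 := sub_one_mem_standardStrip hz
  rw [hh.conj z hz, hh.conj _ hz1] at ha
  exact one_ne_zero (sub_eq_self.1 (hh.injOn (sub_one_mem_standardStrip hz1) hz1 ha))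

theorem map_ne_self (hh : IsStripMap L f h) {z : ℂ} (hz : z ∈ standardStrip L) :
    f (h z) ≠ h z :=
  fun h' => hh.ne_of_map_map_eq (congrArg f h') hz rfl

theorem dist_eq_of_map_add_eq (hh : IsStripMap L f h) {w w' : ℂ} (hw : w ∈ standardStrip L)
    (hw' : w' ∈ standardStrip L) {t t' : ℝ} (heq : h (w + t) = h (w' + t')) :
    dist t t' = dist w w' := by
  have hadd := hh.injOn (add_ofReal_mem_standardStrip hw t) (add_ofReal_mem_standardStrip hw' t')
    heq
  rw [dist_comm, dist_eq_norm, dist_eq_norm, ← Complex.norm_real]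
  congr 1
  push_cast
  linear_combination -hadd

end IsStripMap

/-- The pointwise limit, along an ultrafilter, of maps to the sphere. It always exists because the
sphere is compact. -/
noncomputable def limitMap {ι : Type*} (U : Ultrafilter ι) (h : ι → ℂ → OnePoint ℂ) (z : ℂ) :
    OnePoint ℂ :=
  (U.map fun i => h i z).lim

section Limit

variable {ι : Type*} {U : Ultrafilter ι}

theorem tendsto_limitMap (U : Ultrafilter ι) (h : ι → ℂ → OnePoint ℂ) (z : ℂ) :
    Tendsto (fun i => h i z) U (𝓝 (limitMap U h z)) :=
  (U.map fun i => h i z).le_nhds_lim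

theorem tendstoLocallyUniformlyOn_limitMap_of_omits {h : ι → ℂ → OnePoint ℂ} {W : Set ℂ} {δ : ℝ}
    (hW : IsOpen W) (hh : ∀ᶠ i in U, HolomorphicOn (h i) W) (hi : ∀ᶠ i in U, InjOn (h i) W)
    (hδ : 0 < δ) (hab : ∀ᶠ i in U, ∃ a b, δ ≤ dist a b ∧ ∀ z ∈ W, h i z ≠ a ∧ h i z ≠ b) :
    TendstoLocallyUniformlyOn h (limitMap U h) U W := by
  refine tendstoLocallyUniformlyOn_of_eventually_dist_lt (fun z _ => tendsto_limitMap U h z)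
    fun z hz ε hε => ?_
  obtain ⟨ρ, hρ, hsub⟩ := Metric.isOpen_iff.1 hW z hz
  have hsub : Metric.ball z (2 * (ρ / 2)) ⊆ W := by rwa [mul_div_cancel₀ ρ two_ne_zero]
  have hR : 0 < ρ / 2 := half_pos hρ
  generalize ρ / 2 = R at *
  set K := 3200 / (δ * R)
  have hK : 0 < K := by positivity
  have hs : 0 < min (R / 800) (ε / K) := by positivity
  refine ⟨_, mem_nhdsWithin_of_mem_nhds (Metric.ball_mem_nhds z hs), ?_⟩
  filter_upwards [hh, hi, hab] with i hhi hii ⟨a, b, hab, hne⟩ x hx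
  obtain ⟨hxR, hxε⟩ := lt_min_iff.1 (Metric.mem_ball.1 hx)
  calc dist (h i x) (h i z) ≤ K * ‖x - z‖ :=
        (hhi.mono hsub).dist_le_of_injOn_of_omits hR (hii.mono hsub) hδ hab
          (fun w hw => (hne w (hsub hw)).1) (fun w hw => (hne w (hsub hw)).2) hxR
          (Metric.mem_ball_self (by positivity))
    _ < ε := by rwa [mul_comm, ← lt_div_iff₀ hK, ← dist_eq_norm]

variable {L : ℝ} {f : ι → OnePoint ℂ → OnePoint ℂ} {g : OnePoint ℂ → OnePoint ℂ}
  {h : ι → ℂ → OnePoint ℂ}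

theorem tendstoLocallyUniformlyOn_limitMap (hf : HasSeparatedPrefixedPoints U f)
    (hh : ∀ i, IsStripMap L (f i) (h i)) :
    TendstoLocallyUniformlyOn h (limitMap U h) U (standardStrip L) := by
  obtain ⟨δ, hδ, hsep⟩ := hf
  refine tendstoLocallyUniformlyOn_limitMap_of_omits (isOpen_standardStrip L)
    (.of_forall fun i => (hh i).holomorphicOn) (.of_forall fun i => (hh i).injOn) hδ ?_
  filter_upwards [hsep] with i ⟨a, b, hab, ha, hb⟩
  exact ⟨a, b, hab, fun z hz => ⟨(hh i).ne_of_map_map_eq ha hz, (hh i).ne_of_map_map_eq hb hz⟩⟩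

theorem isStripMap_limitMap_or_const (hL : 0 < L) (hf : HasSeparatedPrefixedPoints U f)
    (hg : Continuous g) (hfg : TendstoUniformly f g U) (hh : ∀ i, IsStripMap L (f i) (h i)) :
    IsStripMap L g (limitMap U h) ∨
      ∃ p, g p = p ∧ ∀ z ∈ standardStrip L, limitMap U h z = p := by
  have hl := tendstoLocallyUniformlyOn_limitMap hf hh
  have hol : ∀ᶠ i in (U : Filter ι), HolomorphicOn (h i) (standardStrip L) :=
    .of_forall fun i => (hh i).holomorphicOn
  have hopen := isOpen_standardStrip L
  have hconj : ∀ z ∈ standardStrip L, g (limitMap U h z) = limitMap U h (z - 1) := fun z hz =>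
    tendsto_nhds_unique (hfg.tendsto_comp hg.continuousAt (tendsto_limitMap U h z))
      ((tendsto_limitMap U h (z - 1)).congr fun i => ((hh i).conj z hz).symm)
  rcases injOn_or_const_of_tendstoLocallyUniformlyOn hopen (convex_standardStrip L).isPreconnected
    hol (.of_forall fun i => (hh i).injOn) hl with hi | ⟨p, hp⟩
  · exact .inl ⟨.of_tendstoLocallyUniformlyOn hopen hol hl, hi, hconj⟩
  · have h0 := ofReal_mem_standardStrip hL 0
    have hgp := hconj _ h0
    rw [hp _ h0, hp _ (sub_one_mem_standardStrip h0)] at hgp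
    exact .inr ⟨p, hgp, hp⟩

theorem eventually_exists_eq_limitMap (hf : HasSeparatedPrefixedPoints U f)
    (hh : ∀ i, IsStripMap L (f i) (h i)) (hlim : InjOn (limitMap U h) (standardStrip L)) {z : ℂ}
    (hz : z ∈ standardStrip L) {r : ℝ} (hr : 0 < r) :
    ∀ᶠ i in U, ∃ w ∈ Metric.ball z r, w ∈ standardStrip L ∧ h i w = limitMap U h z := by
  have hl := tendstoLocallyUniformlyOn_limitMap hf hh
  exact eventually_exists_eq_of_tendstoLocallyUniformlyOn (isOpen_standardStrip L)
    (.of_forall fun i => (hh i).holomorphicOn) (.of_forall fun _ => holomorphicOn_const _ _) hl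
    (tendsto_const_nhds.tendstoUniformlyOn_const _).tendstoLocallyUniformlyOn
    (hl.continuousOn (.of_forall fun i => (hh i).holomorphicOn.1)) continuousOn_const hz rfl
    (eventually_nhdsNE_ne_of_injOn (standardStrip_mem_nhds hz) hlim) hr

/-- The limit, along an ultrafilter, of the maps `h i` rebased at the real points `t i`. -/
noncomputable def basedLimit (U : Ultrafilter ι) (h : ι → ℂ → OnePoint ℂ) (t : ι → ℝ) :
    ℂ → OnePoint ℂ :=
  limitMap U fun i z => h i (z + t i)

theorem eventually_dist_le_of_basedLimit_eq (hf : HasSeparatedPrefixedPoints U f)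
    (hh : ∀ i, IsStripMap L (f i) (h i)) {t t' : ι → ℝ}
    (ht : InjOn (basedLimit U h t) (standardStrip L))
    (ht' : InjOn (basedLimit U h t') (standardStrip L)) {z z' : ℂ}
    (hz : z ∈ standardStrip L) (hz' : z' ∈ standardStrip L)
    (heq : basedLimit U h t z = basedLimit U h t' z') :
    ∀ᶠ i in U, dist (t i) (t' i) ≤ dist z z' + 2 := by
  filter_upwards [
    eventually_exists_eq_limitMap hf (fun i => (hh i).translate (t i)) ht hz one_pos,
    eventually_exists_eq_limitMap hf (fun i => (hh i).translate (t' i)) ht' hz' one_pos]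
    with i ⟨w, hw, hwS, hwz⟩ ⟨w', hw', hwS', hwz'⟩
  rw [(hh i).dist_eq_of_map_add_eq hwS hwS' (hwz.trans (heq.trans hwz'.symm))]
  linarith [dist_triangle4 w z z' w', Metric.mem_ball.1 hw, Metric.mem_ball'.1 hw']

theorem exists_translate_of_basedLimit_eq (hf : HasSeparatedPrefixedPoints U f)
    (hh : ∀ i, IsStripMap L (f i) (h i)) {t t' : ι → ℝ}
    (ht : InjOn (basedLimit U h t) (standardStrip L))
    (ht' : InjOn (basedLimit U h t') (standardStrip L)) {z z' : ℂ}
    (hz : z ∈ standardStrip L) (hz' : z' ∈ standardStrip L)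
    (heq : basedLimit U h t z = basedLimit U h t' z') :
    ∃ c : ℝ, ∀ x ∈ standardStrip L,
      basedLimit U h t' x = basedLimit U h t (x + c) := by
  have hbdd : ∀ᶠ i in U, t' i - t i ∈ Metric.closedBall (0 : ℝ) (dist z z' + 2) := by
    filter_upwards [eventually_dist_le_of_basedLimit_eq hf hh ht ht' hz hz' heq] with i hi
    rwa [mem_closedBall_zero_iff, ← dist_eq_norm, dist_comm]
  obtain ⟨c, -, hc⟩ := (isCompact_closedBall (0 : ℝ) (dist z z' + 2)).ultrafilter_le_nhds
    (U.map fun i => t' i - t i) (le_principal_iff.2 hbdd)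
  have hc : Tendsto (fun i => t' i - t i) U (𝓝 c) := hc
  refine ⟨c, fun x hx => ?_⟩
  have hxc := add_ofReal_mem_standardStrip hx c
  have hcx : Tendsto (fun i => x + ((t' i - t i : ℝ) : ℂ)) U (𝓝[standardStrip L] (x + c)) :=
    tendsto_nhdsWithin_iff.2 ⟨((Complex.continuous_ofReal.tendsto c).comp hc).const_add x,
      .of_forall fun i => add_ofReal_mem_standardStrip hx _⟩
  have hh' := fun i => (hh i).translate (t i)
  have hl := tendstoLocallyUniformlyOn_limitMap hf hh'
  have hlim := tendsto_comp_of_locally_uniform_limit_within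
    (hl.continuousOn (.of_forall fun i => (hh' i).holomorphicOn.1) _ hxc) hcx
    fun u hu => hl u hu _ hxc
  refine tendsto_nhds_unique (tendsto_limitMap U _ x) (hlim.congr fun i => ?_)
  congr 1
  push_cast
  ring

end Limit

theorem IsStripMap.exists_tendsto_fixed {L : ℝ} (hL : 0 < L) {g : OnePoint ℂ → OnePoint ℂ}
    (hg : Continuous g) {a b : OnePoint ℂ} (hab : a ≠ b) (ha : g (g a) = g a)
    (hb : g (g b) = g b) {k : ℂ → OnePoint ℂ} (hk : IsStripMap L g k) {V : Ultrafilter ℝ}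
    (hV : V ≤ cocompact ℝ) : ∃ p, g p = p ∧ Tendsto (fun x : ℝ => k x) V (𝓝 p) := by
  have hsep : HasSeparatedPrefixedPoints (V : Filter ℝ) fun _ => g :=
    ⟨dist a b, dist_pos.2 hab, .of_forall fun _ => ⟨a, b, le_rfl, ha, hb⟩⟩
  have hgg : TendstoUniformly (fun _ : ℝ => g) g V :=
    fun s hs => .of_forall fun _ _ => refl_mem_uniformity hs
  have h0 : (0 : ℂ) ∈ standardStrip L := ofReal_mem_standardStrip hL 0
  rcases isStripMap_limitMap_or_const hL hsep hg hgg fun x => hk.translate x with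
    hinj | ⟨p, hp, hpS⟩
  · -- A point in the image of the limit would be attained near `x` for almost every `x`.
    have hev := eventually_exists_eq_limitMap hsep (fun x => hk.translate x) hinj.injOn h0 one_pos
    obtain ⟨x, w, hw, hwS, hwk⟩ := hev.exists
    have hfar : ∀ᶠ y in V, y ∉ Metric.closedBall x 2 :=
      hV (isCompact_closedBall x 2).compl_mem_cocompact
    obtain ⟨y, ⟨w', hw', hwS', hwk'⟩, hy⟩ := (hev.and hfar).exists
    refine absurd (Metric.mem_closedBall.2 ?_) hy
    rw [hk.dist_eq_of_map_add_eq hwS' hwS (hwk'.trans hwk.symm)]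
    linarith [dist_triangle_right w' w 0, Metric.mem_ball.1 hw, Metric.mem_ball.1 hw']
  · refine ⟨p, hp, ?_⟩
    have hlim := tendsto_limitMap V (fun (x : ℝ) z => k (z + x)) 0
    simpa only [zero_add, hpS 0 h0] using hlim

end RiemannSphere

/-! ### Transition maps between conformal parametrizations -/

theorem eventually_deriv_ne_zero_of_injOn {F : ℂ → ℂ} {U : Set ℂ} {z : ℂ} (hF : AnalyticAt ℂ F z)
    (hU : U ∈ 𝓝 z) (hi : InjOn F U) : ∀ᶠ w in 𝓝[≠] z, deriv F w ≠ 0 := by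
  refine hF.deriv.eventually_eq_zero_or_eventually_ne_zero.resolve_left fun hzero => ?_
  obtain ⟨r, hr, hball⟩ := Metric.mem_nhds_iff.1 (hzero.and hF.eventually_analyticAt)
  have hconst : ∀ w ∈ Metric.ball z r, F w = F z := fun w hw =>
    Metric.isOpen_ball.is_const_of_deriv_eq_zero (convex_ball z r).isPreconnected
      (fun v hv => (hball hv).2.differentiableAt.differentiableWithinAt)
      (fun v hv => (hball hv).1) hw (Metric.mem_ball_self hr)
  obtain ⟨w, hw, hwr⟩ := ((eventually_nhdsNE_ne_of_injOn hU hi).and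
    (nhdsWithin_le_nhds (Metric.ball_mem_nhds z hr))).exists
  exact hw (hconst w hwr)

theorem differentiableAt_of_comp_of_injOn {F θ : ℂ → ℂ} {U : Set ℂ} {z : ℂ}
    (hF : AnalyticAt ℂ F (θ z)) (hU : U ∈ 𝓝 (θ z)) (hi : InjOn F U)
    (hθ : ∀ᶠ x in 𝓝 z, ContinuousAt θ x) (hFθ : ∀ᶠ x in 𝓝 z, DifferentiableAt ℂ (F ∘ θ) x) :
    DifferentiableAt ℂ θ z := by
  have hθz := hθ.self_of_nhds
  have hFθz := Complex.analyticAt_iff_eventually_differentiableAt.2 hFθ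
  rcases hFθz.eventually_eq_or_eventually_ne analyticAt_const (g := fun _ => F (θ z)) with heq | hne
  · refine (differentiableAt_const (θ z)).congr_of_eventuallyEq ?_
    filter_upwards [heq, hθz hU] with x hx hxU using hi hxU (mem_of_mem_nhds hU) hx
  have hθne : Tendsto θ (𝓝[≠] z) (𝓝[≠] (θ z)) := by
    refine tendsto_nhdsWithin_iff.2 ⟨hθz.tendsto.mono_left nhdsWithin_le_nhds, ?_⟩
    filter_upwards [hne] with x hx h_eq using hx (congrArg F h_eq)
  refine (Complex.analyticAt_of_differentiable_on_punctured_nhds_of_continuousAt ?_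
    hθz).differentiableAt
  filter_upwards [hθne.eventually (eventually_deriv_ne_zero_of_injOn hF hU hi),
    nhdsWithin_le_nhds (hθz.eventually hF.eventually_analyticAt), nhdsWithin_le_nhds hθ,
    nhdsWithin_le_nhds hFθ] with x hderiv hFx hθx hFθx
  exact (hFx.differentiableAt.hasDerivAt.of_comp_left hθx hFθx.hasDerivAt
    hderiv EventuallyEq.rfl).differentiableAt

namespace RiemannSphere

section Transition

variable {φ₁ φ₂ : ℂ → OnePoint ℂ} {U₁ U₂ : Set ℂ} {θ : ℂ → ℂ}

theorem continuousAt_of_comp_eq (hU₁ : IsOpen U₁) (hU₂ : IsOpen U₂) (h₁ : ContinuousOn φ₁ U₁)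
    (h₂ : HolomorphicOn φ₂ U₂) (hi₂ : InjOn φ₂ U₂) (hm : MapsTo θ U₁ U₂)
    (hθ : ∀ z ∈ U₁, φ₂ (θ z) = φ₁ z) {z : ℂ} (hz : z ∈ U₁) : ContinuousAt θ z := by
  intro V hV
  obtain ⟨W, hWV, hW, hzW⟩ := mem_nhds_iff.1 (inter_mem hV (hU₂.mem_nhds (hm hz)))
  have hWU : W ⊆ U₂ := hWV.trans inter_subset_right
  have hφW : φ₂ '' W ∈ 𝓝 (φ₁ z) := by
    rw [← hθ z hz]
    exact ((h₂.mono hWU).isOpen_image (hi₂.mono hWU) hW).mem_nhds (mem_image_of_mem _ hzW)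
  change θ ⁻¹' V ∈ 𝓝 z
  filter_upwards [hU₁.mem_nhds hz, h₁.continuousAt (hU₁.mem_nhds hz) hφW] with x hx hφx
  obtain ⟨w, hw, hwx⟩ := hφx
  rw [← hθ x hx] at hwx
  rw [mem_preimage, ← hi₂ (hWU hw) (hm hx) hwx]
  exact (hWV hw).1

theorem differentiableAt_of_comp_eq (hU₁ : IsOpen U₁) (hU₂ : IsOpen U₂) (h₁ : HolomorphicOn φ₁ U₁)
    (h₂ : HolomorphicOn φ₂ U₂) (hi₂ : InjOn φ₂ U₂) (hm : MapsTo θ U₁ U₂)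
    (hθ : ∀ z ∈ U₁, φ₂ (θ z) = φ₁ z) {z : ℂ} (hz : z ∈ U₁) : DifferentiableAt ℂ θ z := by
  have hcont : ∀ x ∈ U₁, ContinuousAt θ x := fun x hx =>
    continuousAt_of_comp_eq hU₁ hU₂ h₁.1 h₂ hi₂ hm hθ hx
  obtain ⟨κ, q, hκ, hq⟩ := exists_isChart (φ₁ z)
  have hW : ∀ᶠ w in 𝓝 (θ z), w ∈ U₂ ∧ φ₂ w ≠ q :=
    (hU₂.eventually_mem (hm hz)).and ((h₂.continuousAt (hU₂.mem_nhds (hm hz))).eventually_ne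
      (by rwa [hθ z hz]))
  refine differentiableAt_of_comp_of_injOn (F := fun w => κ (φ₂ w))
    (Complex.analyticAt_iff_eventually_differentiableAt.2 ?_) hW ?_
    ((hU₁.eventually_mem hz).mono hcont) ?_
  · filter_upwards [hW] with w hw using hκ.differentiableAt h₂ hw.1 hw.2
  · exact fun w hw w' hw' heq => hi₂ hw.1 hw'.1 (hκ.injOn hw.2 hw'.2 heq)
  · filter_upwards [hU₁.mem_nhds hz,
      (h₁.continuousAt (hU₁.mem_nhds hz)).eventually_ne hq] with x hx hxq
    refine (hκ.differentiableAt h₁ hx hxq).congr_of_eventuallyEq ?_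
    filter_upwards [hU₁.mem_nhds hx] with y hy using congrArg κ (hθ y hy)

theorem IsConformalIso.exists_transition {A : Set (OnePoint ℂ)} (hU₁ : IsOpen U₁)
    (hU₂ : IsOpen U₂) (h₁ : IsConformalIso φ₁ U₁ A) (h₂ : IsConformalIso φ₂ U₂ A) :
    ∃ θ : ℂ → ℂ, MapsTo θ U₁ U₂ ∧ (∀ z ∈ U₁, DifferentiableAt ℂ θ z) ∧
      ∀ z ∈ U₁, φ₂ (θ z) = φ₁ z := by
  have hex : ∀ z ∈ U₁, φ₁ z ∈ φ₂ '' U₂ := fun z hz => by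
    rw [h₂.2.2, ← h₁.2.2]
    exact mem_image_of_mem φ₁ hz
  choose! θ hm hθ using hex
  exact ⟨θ, hm, fun z hz => differentiableAt_of_comp_eq hU₁ hU₂ h₁.1 h₂.1 h₂.2.1 hm hθ hz, hθ⟩

end Transition

end RiemannSphere

/-! ### The Schwarz–Pick lemma -/

/-- The conformal isomorphism of the upper half-plane onto the unit disc sending `w` to `0`. -/
noncomputable def cayley (w z : ℂ) : ℂ := (z - w) / (z - starRingEnd ℂ w)

/-- The inverse of `cayley w` on the unit disc (junk value `0` at `1`, the image of `∞`). -/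
noncomputable def cayleyInv (w u : ℂ) : ℂ := (w - starRingEnd ℂ w * u) / (1 - u)

section Cayley

variable {w z u : ℂ}

theorem norm_sub_lt_norm_sub_conj (hw : 0 < w.im) (hz : 0 < z.im) :
    ‖z - w‖ < ‖z - starRingEnd ℂ w‖ := by
  rw [← sq_lt_sq₀ (norm_nonneg _) (norm_nonneg _), Complex.sq_norm, Complex.sq_norm,
    Complex.normSq_apply, Complex.normSq_apply]
  simp only [Complex.sub_re, Complex.sub_im, Complex.conj_re, Complex.conj_im]
  nlinarith [mul_pos hz hw]

theorem sub_conj_ne_zero (hw : 0 < w.im) (hz : 0 < z.im) : z - starRingEnd ℂ w ≠ 0 :=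
  norm_pos_iff.1 ((norm_nonneg _).trans_lt (norm_sub_lt_norm_sub_conj hw hz))

theorem norm_cayley_lt_one (hw : 0 < w.im) (hz : 0 < z.im) : ‖cayley w z‖ < 1 := by
  rw [cayley, norm_div, div_lt_one (norm_pos_iff.2 (sub_conj_ne_zero hw hz))]
  exact norm_sub_lt_norm_sub_conj hw hz

theorem cayleyInv_im (w u : ℂ) :
    (cayleyInv w u).im = w.im * (1 - ‖u‖ ^ 2) / ‖1 - u‖ ^ 2 := by
  rw [cayleyInv, Complex.div_im, Complex.sq_norm, Complex.sq_norm, Complex.normSq_apply u]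
  simp only [Complex.sub_re, Complex.sub_im, Complex.mul_re, Complex.mul_im, Complex.conj_re,
    Complex.conj_im, Complex.one_re, Complex.one_im]
  ring

theorem one_sub_ne_zero_of_norm_lt_one (hu : ‖u‖ < 1) : 1 - u ≠ 0 := by
  rw [sub_ne_zero]
  rintro rfl
  simp at hu

theorem cayleyInv_im_pos (hw : 0 < w.im) (hu : ‖u‖ < 1) : 0 < (cayleyInv w u).im := by
  have hu' : 0 < ‖1 - u‖ := norm_pos_iff.2 (one_sub_ne_zero_of_norm_lt_one hu)
  have hu'' : 0 < 1 - ‖u‖ ^ 2 := by nlinarith [norm_nonneg u]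
  rw [cayleyInv_im]
  positivity

theorem differentiableAt_cayleyInv (hu : ‖u‖ < 1) : DifferentiableAt ℂ (cayleyInv w) u :=
  DifferentiableAt.fun_div (by fun_prop) (by fun_prop) (one_sub_ne_zero_of_norm_lt_one hu)

theorem differentiableAt_cayley (hw : 0 < w.im) (hz : 0 < z.im) :
    DifferentiableAt ℂ (cayley w) z :=
  DifferentiableAt.fun_div (by fun_prop) (by fun_prop) (sub_conj_ne_zero hw hz)

theorem cayleyInv_cayley (hw : 0 < w.im) (hz : 0 < z.im) : cayleyInv w (cayley w z) = z := by
  have hzw := sub_conj_ne_zero hw hz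
  rw [cayleyInv, div_eq_iff (one_sub_ne_zero_of_norm_lt_one (norm_cayley_lt_one hw hz)), cayley]
  field_simp
  ring

end Cayley

theorem norm_cayley_le_of_mapsTo_upperHalfPlane {F : ℂ → ℂ}
    (hd : ∀ z : ℂ, 0 < z.im → DifferentiableAt ℂ F z) (hm : ∀ z : ℂ, 0 < z.im → 0 < (F z).im)
    {w z : ℂ} (hw : 0 < w.im) (hz : 0 < z.im) : ‖cayley (F w) (F z)‖ ≤ ‖cayley w z‖ := by
  have hinv : ∀ u ∈ Metric.ball (0 : ℂ) 1, 0 < (cayleyInv w u).im := fun u hu =>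
    cayleyInv_im_pos hw (mem_ball_zero_iff.1 hu)
  have hschwarz := Complex.norm_le_norm_of_mapsTo_ball (R := 1) (z := cayley w z)
    (f := fun u => cayley (F w) (F (cayleyInv w u))) (fun u hu => ?_) (fun u hu => ?_) ?_
    (norm_cayley_lt_one hw hz)
  · rwa [cayleyInv_cayley hw hz] at hschwarz
  · have hFinv := (hd _ (hinv u hu)).comp u (differentiableAt_cayleyInv (mem_ball_zero_iff.1 hu))
    exact ((differentiableAt_cayley (hm w hw) (hm _ (hinv u hu))).comp u
      hFinv).differentiableWithinAt
  · rw [mem_closedBall_zero_iff]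
    exact (norm_cayley_lt_one (hm w hw) (hm _ (hinv u hu))).le
  · simp only [cayleyInv, mul_zero, sub_zero, div_one, cayley, sub_self, zero_div]

theorem norm_cayley_eq_tanh_half_dist (w z : UpperHalfPlane) :
    ‖cayley w z‖ = Real.tanh (dist z w / 2) := by
  rw [UpperHalfPlane.tanh_half_dist, cayley, norm_div, dist_eq_norm, dist_eq_norm]

theorem dist_le_dist_of_mapsTo_upperHalfPlane {F : ℂ → ℂ}
    (hd : ∀ z : ℂ, 0 < z.im → DifferentiableAt ℂ F z) (hm : ∀ z : ℂ, 0 < z.im → 0 < (F z).im)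
    (z w : UpperHalfPlane) :
    dist (⟨F z, hm z z.im_pos⟩ : UpperHalfPlane) ⟨F w, hm w w.im_pos⟩ ≤ dist z w := by
  have htanh := norm_cayley_le_of_mapsTo_upperHalfPlane hd hm w.im_pos z.im_pos
  have hFtanh := norm_cayley_eq_tanh_half_dist ⟨F w, hm w w.im_pos⟩ ⟨F z, hm z z.im_pos⟩
  rw [norm_cayley_eq_tanh_half_dist, ← UpperHalfPlane.coe_mk (F w) (hm w w.im_pos),
    ← UpperHalfPlane.coe_mk (F z) (hm z z.im_pos), hFtanh] at htanh
  have hartanh := Real.artanh_le_artanh (Real.neg_one_lt_tanh _) (Real.tanh_lt_one _) htanh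
  rw [Real.artanh_tanh, Real.artanh_tanh] at hartanh
  linarith

namespace RiemannSphere

theorem IsConformalIso.exists_isometry {φ ψ : ℂ → OnePoint ℂ} {A : Set (OnePoint ℂ)}
    (hφ : IsConformalIso φ {z | 0 < z.im} A) (hψ : IsConformalIso ψ {z | 0 < z.im} A) :
    ∃ Θ : UpperHalfPlane → UpperHalfPlane, Isometry Θ ∧ ∀ w : UpperHalfPlane, ψ (Θ w) = φ w := by
  have hopen : IsOpen {z : ℂ | 0 < z.im} := isOpen_lt continuous_const Complex.continuous_im
  obtain ⟨θ, hθm, hθd, hθ⟩ := hφ.exists_transition hopen hopen hψ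
  obtain ⟨η, hηm, hηd, hη⟩ := hψ.exists_transition hopen hopen hφ
  have hηθ : ∀ z : ℂ, 0 < z.im → η (θ z) = z := fun z hz =>
    hφ.2.1 (hηm (hθm hz)) hz (by rw [hη _ (hθm hz), hθ z hz])
  refine ⟨fun z => ⟨θ z, hθm z.im_pos⟩, Isometry.of_dist_eq fun z w => le_antisymm ?_ ?_,
    fun w => hθ w w.im_pos⟩
  · exact dist_le_dist_of_mapsTo_upperHalfPlane hθd (fun _ hz => hθm hz) z w
  · have hle := dist_le_dist_of_mapsTo_upperHalfPlane hηd (fun _ hz => hηm hz)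
      ⟨θ z, hθm z.im_pos⟩ ⟨θ w, hθm w.im_pos⟩
    simpa only [UpperHalfPlane.coe_mk, hηθ _ z.im_pos, hηθ _ w.im_pos] using hle

end RiemannSphere

/-! ### Geodesics invariant under a homothety -/

section Geodesic

variable {r : {x : ℝ // 0 < x}} {c : ℝ → UpperHalfPlane}

theorem re_eq_zero_of_dist_smul_smul {w : UpperHalfPlane} (hr : (r : ℝ) ≠ 1)
    (hd : dist w (r • r • w) = 2 * dist w (r • w)) : w.re = 0 := by
  obtain ⟨r, hr0⟩ := r
  have hcosh := congrArg Real.cosh hd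
  have hy := w.im_pos
  have hr1 : (1 - r) ^ 4 ≠ 0 := pow_ne_zero 4 (sub_ne_zero.2 (Ne.symm hr))
  rw [Real.cosh_two_mul, Real.sinh_sq, UpperHalfPlane.cosh_dist', UpperHalfPlane.cosh_dist']
    at hcosh
  simp only [UpperHalfPlane.pos_real_re, UpperHalfPlane.pos_real_im] at hcosh
  field_simp at hcosh
  have hfactor : (1 - r) ^ 4 * (w.re ^ 2 * (w.re ^ 2 + w.im ^ 2)) = 0 := by
    linear_combination -hcosh / 2
  have hnorm : w.re ^ 2 + w.im ^ 2 ≠ 0 := by positivity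
  simpa [hr1, hnorm] using hfactor

theorem re_eq_zero_of_isometry_of_smul_mem (hc : Isometry c) (hr : (r : ℝ) ≠ 1)
    (h : ∀ t, r • c t ∈ range c) (t : ℝ) : (c t).re = 0 := by
  choose s hs using h
  have hs_abs : ∀ x y, |s x - s y| = |x - y| := fun x y => by
    rw [← Real.dist_eq, ← Real.dist_eq, ← hc.dist_eq, ← hc.dist_eq x, hs, hs,
      (UpperHalfPlane.isometry_pos_mul r).dist_eq]
  refine re_eq_zero_of_dist_smul_smul hr ?_
  rw [← hs, ← hs, hc.dist_eq, hc.dist_eq, Real.dist_eq, Real.dist_eq]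
  have hne : s (s t) ≠ t := fun h_eq => by
    have him := congrArg UpperHalfPlane.im (hs (s t))
    rw [h_eq, hs, UpperHalfPlane.pos_real_im, UpperHalfPlane.pos_real_im] at him
    have him_pos := (c t).im_pos
    have hrr : (r : ℝ) * r = 1 := mul_right_cancel₀ him_pos.ne' (by linarith)
    exact hr (by nlinarith [r.2])
  rcases abs_eq_abs.1 (hs_abs (s t) t) with htrans | hrefl
  · rw [show t - s (s t) = 2 * (t - s t) by linarith, abs_mul, abs_two]
  · exact absurd (by linarith) hne

theorem range_eq_of_isometry_of_re_eq_zero (hc : Isometry c) (hre : ∀ t, (c t).re = 0) :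
    range c = {w | w.re = 0} := by
  have hlog : Isometry fun t => Real.log (c t).im := Isometry.of_dist_eq fun x y => by
    rw [← hc.dist_eq x y, UpperHalfPlane.dist_of_re_eq ((hre x).trans (hre y).symm)]
  have hsurj : Function.Surjective fun t => Real.log (c t).im :=
    (hlog.affineIsometryOfStrictConvexSpace.toAffineIsometryEquiv rfl).surjective
  refine Subset.antisymm (range_subset_iff.2 hre) fun w hw => ?_
  obtain ⟨t, ht⟩ := hsurj (Real.log w.im)
  exact ⟨t, UpperHalfPlane.ext_re_im ((hre t).trans hw.symm)
    (Real.log_injOn_pos (c t).im_pos w.im_pos ht)⟩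

end Geodesic

/-! ### Central lines -/

namespace RiemannSphere

/-- The conformal isomorphism of the upper half-plane onto the standard strip sending the positive
imaginary axis to the real line. -/
noncomputable def logStrip (L : ℝ) (w : ℂ) : ℂ :=
  (2 * L / Real.pi : ℝ) * Complex.log (-Complex.I * w)

/-- The conformal isomorphism of the standard strip onto the upper half-plane inverse to
`logStrip`; it conjugates the translation by `-1` to a homothety. -/
noncomputable def expStrip (L : ℝ) (z : ℂ) : ℂ :=
  Complex.I * Complex.exp ((Real.pi / (2 * L) : ℝ) * z)

section Strip

variable {L : ℝ} {f : OnePoint ℂ → OnePoint ℂ} {h : ℂ → OnePoint ℂ} {A γ : Set (OnePoint ℂ)}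

theorem logStrip_mem_standardStrip (hL : 0 < L) {w : ℂ} (hw : 0 < w.im) :
    logStrip L w ∈ standardStrip L := by
  have harg : |(-Complex.I * w).arg| < Real.pi / 2 :=
    Complex.abs_arg_lt_pi_div_two_iff.2 (Or.inl (by simpa using hw))
  change |(logStrip L w).im| < L
  rw [logStrip, Complex.im_ofReal_mul, Complex.log_im, abs_mul, abs_of_pos (by positivity)]
  calc 2 * L / Real.pi * |(-Complex.I * w).arg| < 2 * L / Real.pi * (Real.pi / 2) := by gcongr
    _ = L := by field_simp

theorem abs_pi_div_mul_im_lt (hL : 0 < L) {z : ℂ} (hz : z ∈ standardStrip L) :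
    |Real.pi / (2 * L) * z.im| < Real.pi / 2 := by
  have hz : |z.im| < L := hz
  rw [abs_mul, abs_of_pos (by positivity)]
  calc Real.pi / (2 * L) * |z.im| < Real.pi / (2 * L) * L := by gcongr
    _ = Real.pi / 2 := by field_simp

theorem expStrip_im_pos (hL : 0 < L) {z : ℂ} (hz : z ∈ standardStrip L) :
    0 < (expStrip L z).im := by
  rw [expStrip, Complex.I_mul_im, Complex.exp_re, Complex.im_ofReal_mul]
  exact mul_pos (Real.exp_pos _)
    (Real.cos_pos_of_mem_Ioo (abs_lt.1 (abs_pi_div_mul_im_lt hL hz)))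

theorem expStrip_logStrip (hL : L ≠ 0) {w : ℂ} (hw : w ≠ 0) :
    expStrip L (logStrip L w) = w := by
  have hπ : Real.pi / (2 * L) * (2 * L / Real.pi) = 1 := by
    field_simp
  rw [expStrip, logStrip, ← mul_assoc, ← Complex.ofReal_mul, hπ, Complex.ofReal_one, one_mul,
    Complex.exp_log (by simpa using hw), ← mul_assoc, mul_neg, Complex.I_mul_I, neg_neg, one_mul]

theorem logStrip_expStrip (hL : 0 < L) {z : ℂ} (hz : z ∈ standardStrip L) :
    logStrip L (expStrip L z) = z := by
  have hπ : 2 * L / Real.pi * (Real.pi / (2 * L)) = 1 := by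
    field_simp
  have him := abs_lt.1 ((abs_pi_div_mul_im_lt hL hz).trans (half_lt_self Real.pi_pos))
  rw [logStrip, expStrip, ← mul_assoc, neg_mul, Complex.I_mul_I, neg_neg, one_mul,
    Complex.log_exp (by rw [Complex.im_ofReal_mul]; exact him.1)
      (by rw [Complex.im_ofReal_mul]; exact him.2.le),
    ← mul_assoc, ← Complex.ofReal_mul, hπ, Complex.ofReal_one, one_mul]

theorem differentiableAt_logStrip {w : ℂ} (hw : 0 < w.im) :
    DifferentiableAt ℂ (logStrip L) w := by
  have hslit : -Complex.I * w ∈ Complex.slitPlane := Or.inl (by simpa using hw)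
  exact ((differentiableAt_id.const_mul (-Complex.I)).clog hslit).const_mul _

theorem expStrip_sub_one (z : ℂ) :
    expStrip L (z - 1) = (Real.exp (-(Real.pi / (2 * L))) : ℝ) * expStrip L z := by
  rw [expStrip, expStrip, Complex.ofReal_exp, mul_left_comm, ← Complex.exp_add]
  congr 2
  push_cast
  ring

theorem bijOn_logStrip (hL : 0 < L) :
    BijOn (logStrip L) {w | 0 < w.im} (standardStrip L) := by
  refine InvOn.bijOn (f' := expStrip L) ⟨fun w hw => expStrip_logStrip hL.ne' ?_,
    fun z hz => logStrip_expStrip hL hz⟩ (fun w hw => logStrip_mem_standardStrip hL hw)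
    fun z hz => expStrip_im_pos hL hz
  rintro rfl
  exact lt_irrefl _ (show 0 < (0 : ℂ).im from hw)

theorem isConformalIso_comp_logStrip (hL : 0 < L) (hh : IsConformalIso h (standardStrip L) A) :
    IsConformalIso (fun w => h (logStrip L w)) {w | 0 < w.im} A := by
  have hbij := bijOn_logStrip hL
  refine ⟨hh.1.comp (fun w hw => differentiableAt_logStrip hw) hbij.mapsTo,
    hh.2.1.comp hbij.injOn hbij.mapsTo, ?_⟩
  rw [← hh.2.2, ← hbij.image_eq, image_image]

theorem logStrip_of_re_eq_zero {w : ℂ} (hw : 0 ≤ w.im) (hre : w.re = 0) :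
    logStrip L w = ((2 * L / Real.pi * Real.log w.im : ℝ) : ℂ) := by
  have hrot : -Complex.I * w = (w.im : ℂ) := by
    apply Complex.ext <;> simp [hre]
  rw [logStrip, hrot, ← Complex.ofReal_log hw, Complex.ofReal_mul]

theorem image_comp_logStrip_imaginaryAxis (hL : 0 < L) (h : ℂ → OnePoint ℂ) :
    (fun w : UpperHalfPlane => h (logStrip L w)) '' {w | w.re = 0} = range fun x : ℝ => h x := by
  refine Subset.antisymm ?_ (range_subset_iff.2 fun x => ?_)
  · rintro _ ⟨w, hw, rfl⟩
    exact ⟨_, congrArg h (logStrip_of_re_eq_zero w.im_pos.le hw).symm⟩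
  · have hx := ofReal_mem_standardStrip hL x
    refine ⟨⟨expStrip L x, expStrip_im_pos hL hx⟩, ?_, congrArg h (logStrip_expStrip hL hx)⟩
    change (expStrip L x).re = 0
    rw [expStrip, ← Complex.ofReal_mul, ← Complex.ofReal_exp, Complex.I_mul_re,
      Complex.ofReal_im, neg_zero]

theorem isSimplyConnected_image_standardStrip (hL : 0 < L)
    (hh : HolomorphicOn h (standardStrip L)) (hi : InjOn h (standardStrip L)) :
    IsSimplyConnected (h '' standardStrip L) := by
  have : ContractibleSpace (standardStrip L) :=
    (convex_standardStrip L).contractibleSpace ⟨0, by simpa using ofReal_mem_standardStrip hL 0⟩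
  have hopen : IsOpenMap ((standardStrip L).domRestrict h) := fun V hV => by
    have himage : (standardStrip L).domRestrict h '' V = h '' (Subtype.val '' V) := by
      rw [image_image]
      rfl
    have hsub := Subtype.coe_image_subset (standardStrip L) V
    rw [himage]
    exact (hh.mono hsub).isOpen_image (hi.mono hsub)
      ((isOpen_standardStrip L).isOpenMap_subtype_val V hV)
  have hemb : IsEmbedding ((standardStrip L).domRestrict h) :=
    (IsOpenEmbedding.of_continuous_injective_isOpenMap hh.1.domRestrict hi.injective
      hopen).isEmbedding
  have hrange : SimplyConnectedSpace (range ((standardStrip L).domRestrict h)) :=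
    hemb.toHomeomorph.toHomotopyEquiv.simplyConnectedSpace_iff.1 inferInstance
  rwa [range_domRestrict] at hrange

theorem IsStripMap.isInvariantStrip (hL : 0 < L) (hh : IsStripMap L f h) :
    IsInvariantStrip L f (h '' standardStrip L) :=
  ⟨hh.holomorphicOn.isOpen_image hh.injOn (isOpen_standardStrip L),
    isSimplyConnected_image_standardStrip hL hh.holomorphicOn hh.injOn, h,
    ⟨hh.holomorphicOn, hh.injOn, rfl⟩, hh.conj⟩

theorem IsStripMap.image_range_ofReal (hL : 0 < L) (hh : IsStripMap L f h) :
    f '' range (fun x : ℝ => h x) = range fun x : ℝ => h x := by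
  have hconj : f ∘ (fun x : ℝ => h x) = (fun x : ℝ => h x) ∘ (Equiv.subRight (1 : ℝ)) :=
    funext fun x => by
      simp [hh.conj _ (ofReal_mem_standardStrip hL x)]
  rw [← range_comp, hconj, EquivLike.range_comp]

theorem IsStripMap.isCentralLine (hL : 0 < L) (hh : IsStripMap L f h) :
    IsCentralLine f (h '' standardStrip L) (range fun x : ℝ => h x) := by
  have hgeo := UpperHalfPlane.isometry_vertical_line 0
  refine ⟨⟨fun w => h (logStrip L w), _,
    isConformalIso_comp_logStrip hL ⟨hh.holomorphicOn, hh.injOn, rfl⟩, hgeo, ?_⟩,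
    hh.image_range_ofReal hL⟩
  rw [← image_comp_logStrip_imaginaryAxis hL h,
    ← range_eq_of_isometry_of_re_eq_zero hgeo fun _ => rfl, ← range_comp]
  rfl

theorem IsStripMap.map_logStrip (hL : 0 < L) (hh : IsStripMap L f h) {w : ℂ} (hw : 0 < w.im) :
    f (h (logStrip L w)) =
      h (logStrip L ((Real.exp (-(Real.pi / (2 * L))) : ℝ) * w)) := by
  have hmem := logStrip_mem_standardStrip hL hw
  have hne : w ≠ 0 := by
    rintro rfl
    exact lt_irrefl _ hw
  rw [hh.conj _ hmem]
  nth_rw 2 [← expStrip_logStrip hL.ne' hne]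
  rw [← expStrip_sub_one, logStrip_expStrip hL (sub_one_mem_standardStrip hmem)]

theorem IsCentralLine.eq_range (hL : 0 < L) (hh : IsStripMap L f h)
    (hA : h '' standardStrip L = A) (hγ : IsCentralLine f A γ) : γ = range fun x : ℝ => h x := by
  obtain ⟨⟨φ, c, hφ, hc, rfl⟩, hinv⟩ := hγ
  have hψ := isConformalIso_comp_logStrip hL ⟨hh.holomorphicOn, hh.injOn, hA⟩
  obtain ⟨Θ, hΘ, hψΘ⟩ := hφ.exists_isometry hψ
  let r : {x : ℝ // 0 < x} := ⟨Real.exp (-(Real.pi / (2 * L))), Real.exp_pos _⟩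
  have hr : (r : ℝ) ≠ 1 := by
    rw [Ne, Real.exp_eq_one_iff, neg_eq_zero]
    positivity
  have hsmul : ∀ t, r • (Θ ∘ c) t ∈ range (Θ ∘ c) := fun t => by
    obtain ⟨s, hs : φ (c s) = f (φ (c t))⟩ := hinv.subset (mem_image_of_mem f (mem_range_self t))
    refine ⟨s, UpperHalfPlane.ext (hψ.2.1 ((Θ ∘ c) s).im_pos (r • (Θ ∘ c) t).im_pos ?_)⟩
    change h (logStrip L (Θ (c s))) = _
    rw [hψΘ, hs, ← hψΘ, hh.map_logStrip hL (Θ (c t)).im_pos]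
    rfl
  have hrange := range_eq_of_isometry_of_re_eq_zero (hΘ.comp hc)
    (re_eq_zero_of_isometry_of_smul_mem (hΘ.comp hc) hr hsmul)
  rw [← image_comp_logStrip_imaginaryAxis hL h, ← hrange, ← range_comp]
  exact congrArg range (funext fun t => (hψΘ (c t)).symm)

end Strip

end RiemannSphere

/-! ### Hausdorff limits of central lines -/

theorem mem_of_tendsto_of_hausdorffEDist {X ι : Type*} [PseudoEMetricSpace X] {l : Filter ι}
    [l.NeBot] {s : ι → Set X} {Γ : Set X} (hΓ : IsClosed Γ)
    (hlim : Tendsto (fun i => Metric.hausdorffEDist (s i) Γ) l (𝓝 0)) {x : ι → X} {p : X}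
    (hx : ∀ i, x i ∈ s i) (hp : Tendsto x l (𝓝 p)) : p ∈ Γ := by
  rw [Metric.mem_iff_infEDist_zero_of_closed hΓ, ← nonpos_iff_eq_zero]
  have hsum := hlim.add (tendsto_iff_edist_tendsto_0.1 hp)
  rw [add_zero] at hsum
  refine ge_of_tendsto' hsum fun i => ?_
  calc Metric.infEDist p Γ ≤ Metric.infEDist (x i) Γ + edist p (x i) :=
        Metric.infEDist_le_infEDist_add_edist
    _ ≤ Metric.hausdorffEDist (s i) Γ + edist (x i) p := by
        rw [edist_comm]
        gcongr
        exact Metric.infEDist_le_hausdorffEDist_of_mem (hx i)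

theorem exists_mem_edist_le_infEDist_add {X : Type*} [PseudoEMetricSpace X] {s : Set X}
    (hs : s.Nonempty) (p : X) {ε : ENNReal} (hε : ε ≠ 0) :
    ∃ x ∈ s, edist p x ≤ Metric.infEDist p s + ε := by
  rcases eq_or_ne (Metric.infEDist p s) ⊤ with htop | htop
  · obtain ⟨x, hx⟩ := hs
    exact ⟨x, hx, by simp [htop]⟩
  · obtain ⟨x, hx, hlt⟩ := Metric.infEDist_lt_iff.1 (ENNReal.lt_add_right htop hε)
    exact ⟨x, hx, hlt.le⟩

theorem exists_tendsto_of_hausdorffEDist {X : Type*} [PseudoEMetricSpace X] {s : ℕ → Set X}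
    {Γ : Set X} (hs : ∀ n, (s n).Nonempty)
    (hlim : Tendsto (fun n => Metric.hausdorffEDist (s n) Γ) atTop (𝓝 0)) {p : X} (hp : p ∈ Γ) :
    ∃ x : ℕ → X, (∀ n, x n ∈ s n) ∧ Tendsto x atTop (𝓝 p) := by
  choose x hx hle using fun n : ℕ =>
    exists_mem_edist_le_infEDist_add (hs n) p (ENNReal.inv_ne_zero.2 (ENNReal.natCast_ne_top n))
  refine ⟨x, hx, tendsto_iff_edist_tendsto_0.2 ?_⟩
  have hbound := hlim.add ENNReal.tendsto_inv_nat_nhds_zero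
  rw [add_zero] at hbound
  refine tendsto_of_tendsto_of_tendsto_of_le_of_le tendsto_const_nhds hbound (fun _ => zero_le)
    fun n => ?_
  calc edist (x n) p ≤ Metric.infEDist p (s n) + (n : ENNReal)⁻¹ := by
        rw [edist_comm]
        exact hle n
    _ ≤ Metric.hausdorffEDist (s n) Γ + (n : ENNReal)⁻¹ := by
        rw [Metric.hausdorffEDist_comm]
        gcongr
        exact Metric.infEDist_le_hausdorffEDist_of_mem hp

theorem mem_iff_exists_tendsto_of_hausdorffEDist {X α : Type*} [PseudoEMetricSpace X] [Nonempty α]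
    {c : ℕ → α → X} {Γ : Set X} (hΓ : IsClosed Γ)
    (hlim : Tendsto (fun n => Metric.hausdorffEDist (range (c n)) Γ) atTop (𝓝 0)) {l : Filter ℕ}
    [l.NeBot] (hl : l ≤ atTop) {p : X} :
    p ∈ Γ ↔ ∃ t : ℕ → α, Tendsto (fun n => c n (t n)) l (𝓝 p) := by
  constructor
  · intro hp
    obtain ⟨x, hx, hxp⟩ :=
      exists_tendsto_of_hausdorffEDist (fun n => range_nonempty (c n)) hlim hp
    choose t ht using hx
    exact ⟨t, (hxp.mono_left hl).congr fun n => (ht n).symm⟩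
  · rintro ⟨t, ht⟩
    exact mem_of_tendsto_of_hausdorffEDist hΓ (hlim.mono_left hl) (fun n => mem_range_self (t n)) ht

theorem exists_mem_Icc_eq_forall_le {α : Type*} [LinearOrder α] [TopologicalSpace α]
    [OrderClosedTopology α] {D : ℝ → α} {a b : ℝ} {r : α} (hab : a ≤ b)
    (hD : ContinuousOn D (Icc a b)) (ha : D a ≤ r) (hb : r ≤ D b) :
    ∃ x ∈ Icc a b, D x = r ∧ ∀ y ∈ Icc a x, D y ≤ r := by
  have hlevel : IsCompact (Icc a b ∩ D ⁻¹' {r}) :=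
    isCompact_Icc.of_isClosed_subset (hD.preimage_isClosed_of_isClosed isClosed_Icc
      isClosed_singleton) inter_subset_left
  obtain ⟨x, ⟨hx, hxr⟩, hmin⟩ :=
    hlevel.exists_isLeast (intermediate_value_Icc hab hD ⟨ha, hb⟩)
  refine ⟨x, hx, hxr, fun y hy => ?_⟩
  by_contra! hlt
  obtain ⟨z, hz, hzr⟩ := intermediate_value_Icc hy.1
    (hD.mono (Icc_subset_Icc_right (hy.2.trans hx.2))) ⟨ha, hlt.le⟩
  have hxz : x ≤ z := hmin ⟨⟨hz.1, hz.2.trans (hy.2.trans hx.2)⟩, hzr⟩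
  rw [le_antisymm hy.2 (hxz.trans hz.2), hxr] at hlt
  exact lt_irrefl _ hlt

theorem exists_lt_forall_dist_le_imp_eq {X : Type*} [MetricSpace X] {F : Set X} (hF : F.Finite)
    (p : X) {R : ℝ} (hR : 0 < R) : ∃ r > 0, r < R ∧ ∀ x ∈ F, dist x p ≤ r → x = p := by
  have hnhds : (F \ {p})ᶜ ∈ 𝓝 p := hF.sdiff.isClosed.isOpen_compl.mem_nhds (by simp)
  obtain ⟨r, hr, hball⟩ := Metric.nhds_basis_closedBall.mem_iff.1 hnhds
  refine ⟨min r (R / 2), lt_min hr (half_pos hR), (min_le_right _ _).trans_lt (half_lt_self hR),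
    fun x hxF hx => ?_⟩
  by_contra hne
  exact hball (Metric.mem_closedBall.2 (hx.trans (min_le_left _ _))) ⟨hxF, hne⟩

theorem exists_exit_time {ι X : Type*} [PseudoMetricSpace X] {l : Filter ι} [l.NeBot]
    {c : ι → ℝ → X} (hc : ∀ i, Continuous (c i)) {p : X} {m : ι → ℝ} (hm : ∀ᶠ i in l, 0 ≤ m i)
    {r : ℝ} (hstart : ∀ᶠ i in l, dist (c i 0) p ≤ r)
    (hend : ∀ᶠ i in l, r ≤ dist (c i (m i)) p) :
    ∃ x : ι → ℝ, ∀ᶠ i in l, 0 ≤ x i ∧ dist (c i (x i)) p = r ∧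
      ∀ y ∈ Icc 0 (x i), dist (c i y) p ≤ r := by
  suffices hexit : ∀ᶠ i in l, ∃ x, 0 ≤ x ∧ dist (c i x) p = r ∧ ∀ y ∈ Icc 0 x, dist (c i y) p ≤ r
    from hexit.choice
  filter_upwards [hm, hstart, hend] with i hmi hsi hei
  obtain ⟨x, hx, hxr, hle⟩ :=
    exists_mem_Icc_eq_forall_le hmi ((hc i).dist continuous_const).continuousOn hsi hei
  exact ⟨x, hx.1, hxr, hle⟩

namespace RiemannSphere

theorem IsStripMap.mem_closure_range_of_dist_le {L : ℝ} (hL : 0 < L)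
    {g : OnePoint ℂ → OnePoint ℂ} {d : ℕ} (hd : 2 ≤ d) (hg : IsRationalMap d g)
    {k : ℂ → OnePoint ℂ} (hk : IsStripMap L g k) {σ : ℝ} (hσ : σ ≠ 0) {p : OnePoint ℂ} {r : ℝ}
    (hle : ∀ y : ℝ, 0 ≤ y → dist (k ((σ * y : ℝ) : ℂ)) p ≤ r)
    (hfix : ∀ x, g x = x → dist x p ≤ r → x = p) : p ∈ closure (range fun x : ℝ => k x) := by
  obtain ⟨a, b, hab, ha, hb⟩ := hg.exists_fixed_and_preperiodic hd
  have hb2 : g (g b) = g b := by rcases hb with hb | hb <;> simp only [hb, ha]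
  have hσ_infty : Tendsto (fun y : ℝ => σ * y) atTop (cocompact ℝ) :=
    (Homeomorph.mulLeft₀ σ hσ).isClosedEmbedding.tendsto_cocompact.mono_left atTop_le_cocompact
  have hV := Ultrafilter.of_le (map (fun y : ℝ => σ * y) atTop)
  obtain ⟨p', hp', hlim⟩ := hk.exists_tendsto_fixed hL hg.isHolomorphic.continuous hab
    (congrArg g ha) hb2 (hV.trans hσ_infty)
  have hp'r : dist p' p ≤ r := le_of_tendsto (hlim.dist tendsto_const_nhds)
    (hV (eventually_map.2 ((eventually_ge_atTop 0).mono hle)))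
  rw [← hfix p' hp' hp'r]
  exact mem_closure_of_tendsto hlim (.of_forall fun y => mem_range_self y)

section Based

variable {ι : Type*} {U : Ultrafilter ι} {L : ℝ} {f : ι → OnePoint ℂ → OnePoint ℂ}
  {g : OnePoint ℂ → OnePoint ℂ} {h : ι → ℂ → OnePoint ℂ} {t : ι → ℝ} {p : OnePoint ℂ}

theorem tendsto_basedLimit (U : Ultrafilter ι) (h : ι → ℂ → OnePoint ℂ) (t : ι → ℝ) (x : ℝ) :
    Tendsto (fun i => h i ((t i + x : ℝ) : ℂ)) U (𝓝 (basedLimit U h t x)) :=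
  (tendsto_limitMap U _ _).congr fun i => by rw [← Complex.ofReal_add, add_comm]

theorem basedLimit_zero (ht : Tendsto (fun i => h i (t i)) U (𝓝 p)) : basedLimit U h t 0 = p :=
  tendsto_nhds_unique (by simpa using tendsto_basedLimit U h t 0) ht

theorem isStripMap_basedLimit (hL : 0 < L) (hf : HasSeparatedPrefixedPoints U f)
    (hg : Continuous g) (hfg : TendstoUniformly f g U) (hh : ∀ i, IsStripMap L (f i) (h i))
    (ht : Tendsto (fun i => h i (t i)) U (𝓝 p)) (hp : g p ≠ p) :
    IsStripMap L g (basedLimit U h t) := by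
  rcases isStripMap_limitMap_or_const hL hf hg hfg fun i => (hh i).translate (t i) with
    hstrip | ⟨p', hp', hconst⟩
  · exact hstrip
  · have hpp' : p = p' := (basedLimit_zero ht).symm.trans (hconst 0 (ofReal_mem_standardStrip hL 0))
    rw [hpp'] at hp
    exact absurd hp' hp

theorem basedLimit_eq_of_tendsto_fixed (hL : 0 < L) (hf : HasSeparatedPrefixedPoints U f)
    (hg : Continuous g) (hfg : TendstoUniformly f g U) (hh : ∀ i, IsStripMap L (f i) (h i))
    (ht : Tendsto (fun i => h i (t i)) U (𝓝 p)) (hp : g p = p) {z : ℂ}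
    (hz : z ∈ standardStrip L) : basedLimit U h t z = p := by
  have h0 : (0 : ℂ) ∈ standardStrip L := ofReal_mem_standardStrip hL 0
  have hp0 := basedLimit_zero ht
  rcases isStripMap_limitMap_or_const hL hf hg hfg fun i => (hh i).translate (t i) with
    hstrip | ⟨p', -, hconst⟩
  · refine absurd ?_ (hstrip.map_ne_self h0)
    change g (basedLimit U h t 0) = basedLimit U h t 0
    rw [hp0, hp]
  · exact (hconst z hz).trans ((hconst 0 h0).symm.trans hp0)

theorem tendsto_abs_sub_atTop_of_eventually_dist_eq (hL : 0 < L)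
    (hf : HasSeparatedPrefixedPoints U f) (hg : Continuous g) (hfg : TendstoUniformly f g U)
    (hh : ∀ i, IsStripMap L (f i) (h i)) (ht : Tendsto (fun i => h i (t i)) U (𝓝 p))
    (hp : g p = p) {τ : ι → ℝ} {r : ℝ} (hr : 0 < r) (hτ : ∀ᶠ i in U, dist (h i (τ i)) p = r) :
    Tendsto (fun i => |τ i - t i|) U atTop := by
  refine tendsto_atTop.2 fun M => ?_
  have hK : IsCompact (Complex.ofReal '' Metric.closedBall 0 M) :=
    (isCompact_closedBall 0 M).image Complex.continuous_ofReal
  have hKS : Complex.ofReal '' Metric.closedBall 0 M ⊆ standardStrip L := by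
    rintro _ ⟨x, -, rfl⟩
    exact ofReal_mem_standardStrip hL x
  have hunif := (tendstoLocallyUniformlyOn_iff_forall_isCompact (isOpen_standardStrip L)).1
    (tendstoLocallyUniformlyOn_limitMap hf fun i => (hh i).translate (t i)) _ hKS hK
  filter_upwards [hτ, Metric.tendstoUniformlyOn_iff.1 hunif r hr] with i hi hclose
  by_contra! hlt
  have hlt' := hclose _ (mem_image_of_mem _ (mem_closedBall_zero_iff.2 hlt.le))
  have hlim : limitMap U (fun i z => h i (z + t i)) ((τ i - t i : ℝ) : ℂ) = p :=
    basedLimit_eq_of_tendsto_fixed hL hf hg hfg hh ht hp (ofReal_mem_standardStrip hL _)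
  rw [hlim, ← Complex.ofReal_add, sub_add_cancel, dist_comm, hi] at hlt'
  exact lt_irrefl _ hlt'

theorem dist_basedLimit_exit_le {σ r : ℝ} {x : ι → ℝ} (hx : Tendsto x U atTop)
    (hle : ∀ᶠ i in U, ∀ y ∈ Icc 0 (x i), dist (h i ((t i + σ * y : ℝ) : ℂ)) p ≤ r) {y : ℝ}
    (hy : 0 ≤ y) : dist (basedLimit U h (fun i => t i + σ * x i) ((-σ * y : ℝ) : ℂ)) p ≤ r := by
  refine le_of_tendsto ((tendsto_basedLimit U h _ _).dist tendsto_const_nhds) ?_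
  filter_upwards [hle, hx.eventually_ge_atTop y] with i hi hyx
  have hback : t i + σ * x i + -σ * y = t i + σ * (x i - y) := by ring
  rw [hback]
  exact hi _ ⟨sub_nonneg.2 hyx, sub_le_self _ hy⟩

/-- If the curves `h i` start near the fixed point `p` and leave a fixed neighbourhood of it in the
direction `σ`, rebasing them at the exit times gives a strip map ending at `p` in the direction
`-σ`. -/
theorem exists_basedLimit_mem_closure (hL : 0 < L) (hf : HasSeparatedPrefixedPoints U f) {d : ℕ}
    (hd : 2 ≤ d) (hg : IsRationalMap d g) (hfg : TendstoUniformly f g U)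
    (hh : ∀ i, IsStripMap L (f i) (h i)) (ht : Tendsto (fun i => h i (t i)) U (𝓝 p))
    (hp : g p = p) {q : OnePoint ℂ} (hqp : q ≠ p) {σ : ℝ} (hσ : |σ| = 1) {m : ι → ℝ}
    (hm : ∀ᶠ i in U, 0 ≤ m i)
    (hq : Tendsto (fun i => h i ((t i + σ * m i : ℝ) : ℂ)) U (𝓝 q)) :
    ∃ τ : ι → ℝ, IsStripMap L g (basedLimit U h τ) ∧
      p ∈ closure (range fun x : ℝ => basedLimit U h τ x) := by
  have hgc := hg.isHolomorphic.continuous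
  obtain ⟨r, hr, hrq, hfix⟩ :=
    exists_lt_forall_dist_le_imp_eq (hg.finite_fixedPoints hd) p (dist_pos.2 hqp)
  obtain ⟨x, hexit⟩ := exists_exit_time (c := fun i y => h i ((t i + σ * y : ℝ) : ℂ))
    (fun i => (hh i).holomorphicOn.1.comp_continuous (by fun_prop)
      fun y => ofReal_mem_standardStrip hL _) hm
    (((ht.dist tendsto_const_nhds).eventually_le_const (by rwa [dist_self])).mono fun i hi => by
      simpa using hi) ((hq.dist tendsto_const_nhds).eventually_const_le hrq)
  set τ : ι → ℝ := fun i => t i + σ * x i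
  have hτ : Tendsto (fun i => h i (τ i)) U (𝓝 (basedLimit U h τ 0)) := by
    simpa using tendsto_basedLimit U h τ 0
  have hτr : ∀ᶠ i in U, dist (h i (τ i)) p = r := hexit.mono fun i hi => hi.2.1
  have hbase : dist (basedLimit U h τ 0) p = r :=
    tendsto_nhds_unique ((hτ.dist tendsto_const_nhds).congr' hτr) tendsto_const_nhds
  have hstrip : IsStripMap L g (basedLimit U h τ) := by
    refine isStripMap_basedLimit hL hf hgc hfg hh hτ fun hfixed => hr.ne ?_
    rw [← hbase, hfix _ hfixed hbase.le, dist_self]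
  have hx : Tendsto x U atTop := by
    refine (tendsto_abs_sub_atTop_of_eventually_dist_eq hL hf hgc hfg hh ht hp hr hτr).congr'
      (hexit.mono fun i hi => ?_)
    rw [add_sub_cancel_left, abs_mul, hσ, one_mul, abs_of_nonneg hi.1]
  have hσ0 : σ ≠ 0 := abs_ne_zero.1 (hσ ▸ one_ne_zero)
  exact ⟨τ, hstrip, hstrip.mem_closure_range_of_dist_le hL hd hg (neg_ne_zero.2 hσ0)
    (fun y => dist_basedLimit_exit_le hx (hexit.mono fun i hi => hi.2.2)) hfix⟩

end Based

section LimitStrips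

variable {ι : Type*} {U : Ultrafilter ι} {L : ℝ} {f : ι → OnePoint ℂ → OnePoint ℂ}
  {g : OnePoint ℂ → OnePoint ℂ} {h : ι → ℂ → OnePoint ℂ}

/-- The set of limits, along an ultrafilter, of points `h i (t i)` with `t i` real. -/
def realLimitSet (U : Ultrafilter ι) (h : ι → ℂ → OnePoint ℂ) : Set (OnePoint ℂ) :=
  {p | ∃ t : ι → ℝ, Tendsto (fun i => h i (t i)) U (𝓝 p)}

/-- The pairs formed by an invariant strip of `g` and its central line that are parametrized by
some based limit of the maps `h i`. -/
def limitStrips (U : Ultrafilter ι) (L : ℝ) (g : OnePoint ℂ → OnePoint ℂ)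
    (h : ι → ℂ → OnePoint ℂ) : Set (Set (OnePoint ℂ) × Set (OnePoint ℂ)) :=
  {e | ∃ t : ι → ℝ, IsStripMap L g (basedLimit U h t) ∧
    basedLimit U h t '' standardStrip L = e.1 ∧ range (fun x : ℝ => basedLimit U h t x) = e.2}

theorem basedLimit_mem_realLimitSet (U : Ultrafilter ι) (h : ι → ℂ → OnePoint ℂ) (t : ι → ℝ)
    (x : ℝ) : basedLimit U h t x ∈ realLimitSet U h :=
  ⟨fun i => t i + x, tendsto_basedLimit U h t x⟩

variable {e e' : Set (OnePoint ℂ) × Set (OnePoint ℂ)}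

theorem isInvariantStrip_of_mem_limitStrips (hL : 0 < L) (he : e ∈ limitStrips U L g h) :
    IsInvariantStrip L g e.1 := by
  obtain ⟨t, ht, hte, -⟩ := he
  exact hte ▸ ht.isInvariantStrip hL

theorem isCentralLine_of_mem_limitStrips (hL : 0 < L) (he : e ∈ limitStrips U L g h) :
    IsCentralLine g e.1 e.2 := by
  obtain ⟨t, ht, hte, hte'⟩ := he
  exact hte ▸ hte' ▸ ht.isCentralLine hL

theorem subset_of_mem_limitStrips (hL : 0 < L) (he : e ∈ limitStrips U L g h) :
    e.2 ⊆ realLimitSet U h \ Function.fixedPoints g := by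
  obtain ⟨t, ht, -, hte⟩ := he
  rw [← hte]
  rintro _ ⟨x, rfl⟩
  exact ⟨basedLimit_mem_realLimitSet U h t x, ht.map_ne_self (ofReal_mem_standardStrip hL x)⟩

theorem subset_of_basedLimit_eq_add {t t' : ι → ℝ} {c : ℝ} (hL : 0 < L)
    (hc : ∀ x ∈ standardStrip L, basedLimit U h t' x = basedLimit U h t (x + c)) :
    basedLimit U h t' '' standardStrip L ⊆ basedLimit U h t '' standardStrip L ∧
      range (fun x : ℝ => basedLimit U h t' x) ⊆ range fun x : ℝ => basedLimit U h t x := by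
  constructor
  · rintro _ ⟨x, hx, rfl⟩
    exact ⟨x + c, add_ofReal_mem_standardStrip hx c, (hc x hx).symm⟩
  · rintro _ ⟨x, rfl⟩
    refine ⟨x + c, ?_⟩
    simp only [hc x (ofReal_mem_standardStrip hL x), Complex.ofReal_add]

theorem subset_of_mem_limitStrips_of_not_disjoint (hL : 0 < L)
    (hf : HasSeparatedPrefixedPoints U f) (hh : ∀ i, IsStripMap L (f i) (h i))
    (he : e ∈ limitStrips U L g h) (he' : e' ∈ limitStrips U L g h) (hee' : ¬Disjoint e.1 e'.1) :
    e'.1 ⊆ e.1 ∧ e'.2 ⊆ e.2 := by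
  obtain ⟨S, ℓ⟩ := e
  obtain ⟨S', ℓ'⟩ := e'
  obtain ⟨t, ht, rfl, rfl⟩ := he
  obtain ⟨t', ht', rfl, rfl⟩ := he'
  obtain ⟨_, ⟨z, hz, rfl⟩, z', hz', heq⟩ := not_disjoint_iff.1 hee'
  obtain ⟨c, hc⟩ := exists_translate_of_basedLimit_eq hf hh ht.injOn ht'.injOn hz hz' heq.symm
  exact subset_of_basedLimit_eq_add hL hc

theorem pairwiseDisjoint_limitStrips (hL : 0 < L) (hf : HasSeparatedPrefixedPoints U f)
    (hh : ∀ i, IsStripMap L (f i) (h i)) : (limitStrips U L g h).PairwiseDisjoint Prod.fst := by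
  intro e he e' he' hne
  by_contra hee'
  have hsub := subset_of_mem_limitStrips_of_not_disjoint hL hf hh he he' hee'
  have hsub' := subset_of_mem_limitStrips_of_not_disjoint hL hf hh he' he
    fun hdisj => hee' hdisj.symm
  exact hne (Prod.ext (hsub'.1.antisymm hsub.1) (hsub'.2.antisymm hsub.2))

theorem countable_limitStrips (hL : 0 < L) (hf : HasSeparatedPrefixedPoints U f)
    (hh : ∀ i, IsStripMap L (f i) (h i)) : (limitStrips U L g h).Countable :=
  (pairwiseDisjoint_limitStrips hL hf hh).countable_of_isOpen
    (fun _ he => (isInvariantStrip_of_mem_limitStrips hL he).1)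
    fun _ he => (isInvariantStrip_of_mem_limitStrips hL he).2.1.nonempty

theorem realLimitSet_diff_fixedPoints (hL : 0 < L) (hf : HasSeparatedPrefixedPoints U f)
    (hg : Continuous g) (hfg : TendstoUniformly f g U) (hh : ∀ i, IsStripMap L (f i) (h i)) :
    realLimitSet U h \ Function.fixedPoints g = ⋃ e : limitStrips U L g h, e.1.2 := by
  refine Subset.antisymm ?_ (iUnion_subset fun e => subset_of_mem_limitStrips hL e.2)
  rintro p ⟨⟨t, ht⟩, hp⟩
  have hstrip := isStripMap_basedLimit hL hf hg hfg hh ht hp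
  exact mem_iUnion.2 ⟨⟨(_, _), t, hstrip, rfl, rfl⟩, 0, by simpa using basedLimit_zero ht⟩

theorem exists_mem_limitStrips_mem_closure (hL : 0 < L) (hf : HasSeparatedPrefixedPoints U f)
    {d : ℕ} (hd : 2 ≤ d) (hg : IsRationalMap d g) (hfg : TendstoUniformly f g U)
    (hh : ∀ i, IsStripMap L (f i) (h i)) {p q : OnePoint ℂ} (hp : p ∈ realLimitSet U h)
    (hgp : g p = p) (hq : q ∈ realLimitSet U h) (hqp : q ≠ p) :
    ∃ e : limitStrips U L g h, p ∈ closure e.1.2 := by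
  obtain ⟨t, ht⟩ := hp
  obtain ⟨s, hs⟩ := hq
  suffices ∃ τ : ι → ℝ, IsStripMap L g (basedLimit U h τ) ∧
      p ∈ closure (range fun x : ℝ => basedLimit U h τ x) by
    obtain ⟨τ, hτ, hpτ⟩ := this
    exact ⟨⟨(_, _), τ, hτ, rfl, rfl⟩, hpτ⟩
  have horder : ∀ᶠ i in U, t i ≤ s i ∨ s i ≤ t i := .of_forall fun i => le_total _ _
  rcases Ultrafilter.eventually_or.1 horder with hts | hst
  · exact exists_basedLimit_mem_closure hL hf hd hg hfg hh ht hgp hqp (σ := 1) (by simp)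
      (hts.mono fun i => sub_nonneg.2) (by simpa using hs)
  · exact exists_basedLimit_mem_closure hL hf hd hg hfg hh ht hgp hqp (σ := -1) (by simp)
      (hst.mono fun i => sub_nonneg.2) (by simpa using hs)

theorem realLimitSet_eq_iUnion_closure (hL : 0 < L) (hf : HasSeparatedPrefixedPoints U f) {d : ℕ}
    (hd : 2 ≤ d) (hg : IsRationalMap d g) (hfg : TendstoUniformly f g U)
    (hh : ∀ i, IsStripMap L (f i) (h i)) (hclosed : IsClosed (realLimitSet U h))
    (hnontrivial : (realLimitSet U h).Nontrivial) :
    realLimitSet U h = ⋃ e : limitStrips U L g h, closure e.1.2 := by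
  refine Subset.antisymm (fun p hp => mem_iUnion.2 ?_) (iUnion_subset fun e =>
    closure_minimal ((subset_of_mem_limitStrips hL e.2).trans sdiff_subset) hclosed)
  by_cases hgp : g p = p
  · obtain ⟨q, hq, hqp⟩ := hnontrivial.exists_ne p
    exact exists_mem_limitStrips_mem_closure hL hf hd hg hfg hh hp hgp hq hqp
  · have hdiff := realLimitSet_diff_fixedPoints hL hf hg.isHolomorphic.continuous hfg hh
    obtain ⟨e, he⟩ := mem_iUnion.1 (hdiff.subset ⟨hp, hgp⟩)
    exact ⟨e, subset_closure he⟩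

end LimitStrips

theorem IsInvariantStrip.exists_isStripMap {L : ℝ} {f : OnePoint ℂ → OnePoint ℂ}
    {A : Set (OnePoint ℂ)} (hA : IsInvariantStrip L f A) :
    ∃ h, IsStripMap L f h ∧ h '' standardStrip L = A := by
  obtain ⟨-, -, h, ⟨hol, hinj, himage⟩, hconj⟩ := hA
  exact ⟨h, ⟨hol, hinj, hconj⟩, himage⟩

end RiemannSphere

open RiemannSphere in
theorem mainTheorem9 (L : ℝ) (hL : 0 < L)
    (f : ℕ → OnePoint ℂ → OnePoint ℂ) (g : OnePoint ℂ → OnePoint ℂ)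
    (hf : ∀ n, ∃ d, 2 ≤ d ∧ RiemannSphere.IsRationalMap d (f n))
    (hg : ∃ d, 2 ≤ d ∧ RiemannSphere.IsRationalMap d g)
    (hfg : TendstoUniformly f g atTop)
    (A γ : ℕ → Set (OnePoint ℂ))
    (hA : ∀ n, RiemannSphere.IsInvariantStrip L (f n) (A n))
    (hγ : ∀ n, RiemannSphere.IsCentralLine (f n) (A n) (γ n))
    (Γ : Set (OnePoint ℂ)) (hΓ : IsCompact Γ)
    (hlim : Tendsto (fun n => Metric.hausdorffEDist (closure (γ n)) Γ) atTop (𝓝 0))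
    (hpt : ∀ p, Γ ≠ {p}) :
    ∃ (E : Type) (S ℓ : E → Set (OnePoint ℂ)),
      Nonempty E ∧ Countable E ∧
      (∀ e, RiemannSphere.IsInvariantStrip L g (S e)) ∧
      (∀ e, RiemannSphere.IsCentralLine g (S e) (ℓ e)) ∧
      Pairwise (fun e e' => Disjoint (S e) (S e')) ∧
      Γ \ Function.fixedPoints g = ⋃ e, ℓ e ∧
      Γ = ⋃ e, closure (ℓ e) := by
  obtain ⟨d, hd, hgd⟩ := hg
  choose h hh hhA using fun n => (hA n).exists_isStripMap
  have hline : ∀ n, γ n = range fun x : ℝ => h n x := fun n => (hγ n).eq_range hL (hh n) (hhA n)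
  simp only [hline, Metric.hausdorffEDist_closure_left] at hlim
  let U := Ultrafilter.of (atTop : Filter ℕ)
  have hU : (U : Filter ℕ) ≤ atTop := Ultrafilter.of_le _
  have hfgU : TendstoUniformly f g U := fun s hs => hU (hfg s hs)
  have hsep : HasSeparatedPrefixedPoints U f := hgd.hasSeparatedPrefixedPoints
    (fun n => (hf n).choose_spec.2.isHolomorphic) hd hfgU
  obtain rfl : Γ = realLimitSet U h :=
    ext fun p => mem_iff_exists_tendsto_of_hausdorffEDist hΓ.isClosed hlim hU
  have hcover := realLimitSet_eq_iUnion_closure hL hsep hd hgd hfgU hh hΓ.isClosed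
    (Set.Nonempty.exists_eq_singleton_or_nontrivial
      ⟨_, basedLimit_mem_realLimitSet U h 0 0⟩ |>.resolve_left fun ⟨p, hp⟩ => hpt p hp)
  obtain ⟨e, -⟩ := mem_iUnion.1 (hcover.subset (basedLimit_mem_realLimitSet U h 0 0))
  exact ⟨limitStrips U L g h, fun e => e.1.1, fun e => e.1.2, ⟨e⟩,
    countable_limitStrips hL hsep hh,
    fun e => isInvariantStrip_of_mem_limitStrips hL e.2,
    fun e => isCentralLine_of_mem_limitStrips hL e.2,
    (pairwiseDisjoint_limitStrips hL hsep hh).subtype _ _,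
    realLimitSet_diff_fixedPoints hL hsep hgd.isHolomorphic.continuous hfgU hh, hcover⟩
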